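/- Let $(Y_n)_{n\ge 0}$ be a Markov chain on the finite state space $\{0,1,\dots,K\}$, $K\ge 1$, whose state $0$ is absorbing, let $P$ be its transition matrix and let $Q=(P(x,y))_{1\le x,y\le K}$ be the sub-transition matrix. Write $\mathbb E_x$ for the expectation when $Y_0=x$, and $\tau=\inf\{n\ge 0: Y_n=0\}$. Assume that $Q$ is irreducible: for all $x,y\in\{1,\dots,K\}$ there is $n\ge 0$ with $Q^n(x,y)>0$. Let $\rho=\max\{|\lambda|:\lambda\in \mathrm{Sp}(Q)\}$ be the spectral radius of $Q$. Then all states $x\in\{1,\dots,K\}$ have the same period $T=\gcd\{n\ge 0: Q^n(x,x)>0\}$, and there are vectors $\nu,\xi\in(0,\infty)^K$ with $$\nu Q=\rho\nu,\qquad Q\xi=\rho\xi,\qquad \sum_{j=1}^K\nu(j)=\sum_{j=1}^K\nu(j)\xi(j)=1 .$$ Fix a state $o\in\{1,\dots,K\}$ and let $C_0=\{y: \exists n\ge 1,\ Q^{nT}(o,y)>0\}$ and $C_j=\{y:\exists x\in C_{j-1},\ Q(x,y)>0\}$ for $1\le j\le T-1$ be the cyclic classes of $Q$. For any such $\nu,\xi$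 and $0\le l\le T-1$ define $v_l,w_l\in\mathbb C^K$ by $$v_l(y)=e^{-2i\pi jl/T}\,\nu(y),\qquad w_l(y)=e^{2i\pi jl/T}\,\xi(y)\qquad (y\in C_j,\ 0\le j\le T-1).$$ Then $v_lQ=\lambda_l v_l$ and $Qw_l=\lambda_l w_l$ with $\lambda_l=\rho e^{2il\pi/T}$, and for every $f:\{1,\dots,K\}\to\mathbb R$ and every $x\in\{1,\dots,K\}$, as $n\to\infty$, $$\mathbb E_x\Big(\frac1n\sum_{k=0}^{n-1}f(Y_k)\,\mathbf 1_{\tau>n}\Big)=\rho^n\,\varphi(f)\sum_{l=0}^{T-1}e^{-2inl\pi/T}\,\langle w_l,\delta_x\rangle\,\langle v_l,\mathbf 1\rangle+o(\rho^n),\qquad \varphi(f)=\sum_{i=1}^K f(i)\nu(i)\xi(i),$$ where $\langle u,v\rangle=\sum_j\overline{u(j)}\,v(j)$. (In the degenerate case $K=1$, $Q=(0)$, one has $T=0$, the sum over $l$ is empty and both sides vanish for $n\ge1$.) -/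

import Mathlib

open MeasureTheory Filter Asymptotics

noncomputable section

namespace QuasiErgodic

/-- `Y` is, under `μ`, a time-homogeneous Markov chain on the finite state space `S` with
transition matrix `P`, started at `x`: for every path `a₀, …, aₙ₊₁`,
`μ(Y₀ = a₀, …, Yₙ₊₁ = aₙ₊₁) = μ(Y₀ = a₀, …, Yₙ = aₙ) P(aₙ, aₙ₊₁)`. -/
structure IsMarkovChainFrom {S Ω : Type*} [MeasurableSpace S] [MeasurableSpace Ω]
    (P : Matrix S S ℝ) (x : S) (μ : Measure Ω) (Y : ℕ → Ω → S) : Prop where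
  measurable : ∀ n, Measurable (Y n)
  initial : ∀ᵐ ω ∂μ, Y 0 ω = x
  markov : ∀ (n : ℕ) (a : ℕ → S),
    μ {ω | ∀ k ≤ n + 1, Y k ω = a k} =
      μ {ω | ∀ k ≤ n, Y k ω = a k} * ENNReal.ofReal (P (a n) (a (n + 1)))

/-- The absorption time `τ = inf {n ≥ 0 : Yₙ = 0}`, equal to `⊤` if `0` is never reached. -/
def absorptionTime {K : ℕ} {Ω : Type*} (Y : ℕ → Ω → Fin (K + 1)) (ω : Ω) : ℕ∞ :=
  ⨅ n : {n : ℕ // Y n ω = 0}, ((n : ℕ) : ℕ∞)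

/-- `𝔼ₓ((1/n) ∑_{k<n} f(Y_k) 𝟙_{τ > n})`, where `f` is a function on `{1, …, K}`. The state `i + 1`
of `{1, …, K}` is the index `i` of `Fin K`. The value `0` given to `f` at the cemetery plays no
role, since `Y_k ≠ 0` for `k < n < τ`. -/
def killedMean {K : ℕ} {Ω : Type*} [MeasurableSpace Ω] (μ : Measure Ω)
    (Y : ℕ → Ω → Fin (K + 1)) (f : Fin K → ℝ) (n : ℕ) : ℝ :=
  ∫ ω, {ω | (n : ℕ∞) < absorptionTime Y ω}.indicator
    (fun ω => (1 / (n : ℝ)) * ∑ k ∈ Finset.range n, (Fin.cons 0 f : Fin (K + 1) → ℝ) (Y k ω)) ω ∂μ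

/-- The sub-transition matrix: the restriction of `P` to the non-absorbed states `{1, …, K}`. -/
def subTransition {K : ℕ} (P : Matrix (Fin (K + 1)) (Fin (K + 1)) ℝ) : Matrix (Fin K) (Fin K) ℝ :=
  P.submatrix Fin.succ Fin.succ

section Matrices

variable {K : ℕ} (Q : Matrix (Fin K) (Fin K) ℝ)

/-- Irreducibility of the nonnegative matrix `Q`. -/
def Irred : Prop := ∀ x y, ∃ n : ℕ, 0 < (Q ^ n) x y

/-- The period of the state `x`: the greatest common divisor of `{n : Qⁿ(x, x) > 0}`. -/
def period (x : Fin K) : ℕ := Nat.setGcd {n : ℕ | 0 < (Q ^ n) x x}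

/-- The spectral radius of `Q`: the largest modulus of a complex eigenvalue. -/
def specRad : ℝ := (spectralRadius ℂ (Q.map ((↑) : ℝ → ℂ))).toReal

/-- The cyclic classes `C₀, C₁, …` of `Q`, numbered from the class of the reference state `o`. -/
def cyclicClass (o : Fin K) : ℕ → Set (Fin K)
  | 0 => {y | ∃ n : ℕ, 1 ≤ n ∧ 0 < (Q ^ (n * period Q o)) o y}
  | i + 1 => {y | ∃ x ∈ cyclicClass o i, 0 < Q x y}

/-- The index `j` of the class of `y`, that is, the least `j` with `y ∈ C_j`. When `Q` is
irreducible of period `T ≥ 1`, it is the only `j < T` with `y ∈ C_j`. -/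
def classIndex (o y : Fin K) : ℕ := sInf {j : ℕ | y ∈ cyclicClass Q o j}

/-- `ν` and `ξ` are positive left and right eigenvectors of `Q` for its spectral radius, with
`⟨ν, 𝟙⟩ = ⟨ν, ξ⟩ = 1`. -/
structure IsPerronPair (ν ξ : Fin K → ℝ) : Prop where
  left_pos : ∀ j, 0 < ν j
  right_pos : ∀ j, 0 < ξ j
  left_eigen : Matrix.vecMul ν Q = specRad Q • ν
  right_eigen : Matrix.mulVec Q ξ = specRad Q • ξ
  left_normalized : ∑ j, ν j = 1
  pair_normalized : ∑ j, ν j * ξ j = 1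

/-- The peripheral eigenvalue `λ_l = ρ e^{2iπl/T}`. -/
def peripheral (o : Fin K) (l : ℕ) : ℂ :=
  (specRad Q : ℂ) * Complex.exp (2 * Complex.I * l * Real.pi / (period Q o : ℂ))

/-- `v_l = e^{-2iπjl/T} ν` on the class `C_j`. -/
def leftVec (o : Fin K) (ν : Fin K → ℝ) (l : ℕ) (y : Fin K) : ℂ :=
  Complex.exp (-(2 * Complex.I * Real.pi * (classIndex Q o y : ℂ) * l / (period Q o : ℂ))) * ν y

/-- `w_l = e^{2iπjl/T} ξ` on the class `C_j`. -/
def rightVec (o : Fin K) (ξ : Fin K → ℝ) (l : ℕ) (y : Fin K) : ℂ :=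
  Complex.exp (2 * Complex.I * Real.pi * (classIndex Q o y : ℂ) * l / (period Q o : ℂ)) * ξ y

end Matrices

/-- The Hermitian product `⟨u, v⟩ = ∑ⱼ conj(uⱼ) vⱼ` on `ℂ^K`. -/
def herm {K : ℕ} (u v : Fin K → ℂ) : ℂ :=
  inner ℂ (WithLp.toLp 2 u : EuclideanSpace ℂ (Fin K)) (WithLp.toLp 2 v)

/-- `φ(f) = ∑ᵢ f(i) ν(i) ξ(i)`. -/
def phi {K : ℕ} (ν ξ f : Fin K → ℝ) : ℝ := ∑ i, f i * ν i * ξ i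

end QuasiErgodic

end

/-!
Write `ρ` for the spectral radius, `T` for the period, `c(y)` for the class of `y` modulo `T`.

The Markov property turns the killed mean into `(1/n) ∑_{k<n} (Q^k (f · Q^{n-k} 𝟙))(x)`
(`killedMean_eq`). Positive eigenvectors `ν`, `ξ` come from the Collatz–Wielandt maximum on the
simplex (`exists_pos_eigenvector`), and positivity forces their eigenvalue to be `ρ`
(`spectralRadius_eq_of_pos_eigenvectors`).

Each step of `Q` raises `c` by one (`cast_classIndex_eq_add`). Hence `v_l` and `w_l`, whose phases
are characters of `ℤ/T` composed with `c`, are eigenvectors. The sum over `l` in the expansion is,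
by orthogonality of characters, `T ξ(x) ∑ ν(y)` over the `y` with `c(y) = c(x) + n`
(`sum_peripheral_eq_classMean`).

For the asymptotics, the Doob transform `R(x, y) = Q(x, y) ξ(y) / (ρ ξ(x))` is a stochastic matrix
with invariant probability `π = ν ξ`. All classes have mass `1 / T` under `π`, and some power
`R ^ N` is bounded below along the transitions allowed by `c` (`exists_forall_pow_apply_pos`), hence
contracts the vectors whose class means vanish. So `R ^ n h` approaches the class mean of `h` at
`c(x) + n` (`tendsto_norm_pow_mulVec_sub`). In `R^k (f · R^{n-k} h)` the second factor may then be
replaced by a function of the class, and the class at time `n` is `c(x) + n` for every `k`, so this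
function factors out; what remains is the time average of `R^k f`, which tends to
`π(f) = ∑ f ν ξ` (`tendsto_cesaro_two_sided`). With `h = 1 / ξ` this is the expansion.

If `T = 0`, then `Q` is the `1 × 1` zero matrix and both sides vanish for `n ≥ 1`.
-/

/-! ### Nonnegative matrices and the Perron eigenvectors -/

namespace QuasiErgodic

section NonnegMatrix

open Matrix

variable {ι : Type*} [Fintype ι] {A : Matrix ι ι ℝ}

lemma mulVec_apply_pos (hA : ∀ i j, 0 < A i j) {x : ι → ℝ} (hx : ∀ i, 0 ≤ x i) (hx0 : x ≠ 0)
    (i : ι) : 0 < (A *ᵥ x) i := by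
  obtain ⟨j, hj⟩ := Function.ne_iff.mp hx0
  exact Finset.sum_pos' (fun k _ => mul_nonneg (hA i k).le (hx k))
    ⟨j, Finset.mem_univ _, mul_pos (hA i j) (lt_of_le_of_ne (hx j) (Ne.symm hj))⟩

variable [DecidableEq ι]

lemma pow_apply_nonneg (hA : ∀ i j, 0 ≤ A i j) (n : ℕ) (i j : ι) : 0 ≤ (A ^ n) i j := by
  induction n generalizing j with
  | zero => rw [pow_zero, Matrix.one_apply]; split_ifs <;> norm_num
  | succ n ih =>
    rw [pow_succ, Matrix.mul_apply]
    exact Finset.sum_nonneg fun k _ => mul_nonneg (ih k) (hA k j)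

lemma pow_add_apply_pos (hA : ∀ i j, 0 ≤ A i j) {m n : ℕ} {i j k : ι}
    (hm : 0 < (A ^ m) i j) (hn : 0 < (A ^ n) j k) : 0 < (A ^ (m + n)) i k := by
  rw [pow_add, Matrix.mul_apply]
  exact Finset.sum_pos' (fun l _ => mul_nonneg (pow_apply_nonneg hA _ _ _)
    (pow_apply_nonneg hA _ _ _)) ⟨j, Finset.mem_univ _, mul_pos hm hn⟩

lemma pow_succ_apply_pos_iff (hA : ∀ i j, 0 ≤ A i j) {n : ℕ} {i k : ι} :
    0 < (A ^ (n + 1)) i k ↔ ∃ j, 0 < (A ^ n) i j ∧ 0 < A j k := by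
  refine ⟨fun h => ?_, fun ⟨j, h₁, h₂⟩ => pow_add_apply_pos hA h₁ (by rwa [pow_one])⟩
  rw [pow_succ, Matrix.mul_apply] at h
  obtain ⟨j, -, hj⟩ := Finset.exists_lt_of_sum_lt (s := Finset.univ) (f := fun _ => (0 : ℝ))
    (by simpa using h)
  have h₁ := pow_apply_nonneg hA n i j
  exact ⟨j, pos_of_mul_pos_left hj (hA j k), pos_of_mul_pos_right hj h₁⟩

lemma pow_mulVec_eigen {r : ℝ} {x : ι → ℝ} (h : A *ᵥ x = r • x) (n : ℕ) :
    (A ^ n) *ᵥ x = r ^ n • x := by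
  induction n with
  | zero => simp
  | succ n ih => rw [pow_succ, ← Matrix.mulVec_mulVec, h, Matrix.mulVec_smul, ih, smul_smul,
      pow_succ, mul_comm]

lemma exists_sum_pow_apply_pos (hA : ∀ i j, 0 ≤ A i j) (hirr : ∀ i j, ∃ n : ℕ, 0 < (A ^ n) i j) :
    ∃ N : ℕ, ∀ i j, 0 < (∑ k ∈ Finset.range N, A ^ k) i j := by
  choose n hn using hirr
  refine ⟨(∑ i, ∑ j, n i j) + 1, fun i j => ?_⟩
  rw [Matrix.sum_apply]
  refine Finset.sum_pos' (fun k _ => pow_apply_nonneg hA k i j) ⟨n i j, ?_, hn i j⟩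
  have h₁ : n i j ≤ ∑ j, n i j := Finset.single_le_sum (fun _ _ => Nat.zero_le _)
    (Finset.mem_univ j)
  have h₂ : ∑ j, n i j ≤ ∑ i, ∑ j, n i j :=
    Finset.single_le_sum (f := fun i => ∑ j, n i j) (fun _ _ => Nat.zero_le _) (Finset.mem_univ i)
  rw [Finset.mem_range]; omega

/-- Existence of a positive eigenvector, after Collatz and Wielandt: the largest `r` with
`r x ≤ A x` for some `x` in the simplex is attained, by compactness. If `A x ≠ r x` there, the
positive matrix `B = ∑ Aᵏ`, which commutes with `A`, turns the inequality into the strict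
`r B x < A B x`, so `r` was not maximal. Finally `x` is proportional to `B x`, hence positive. -/
theorem exists_pos_eigenvector [Nonempty ι] (hA : ∀ i j, 0 ≤ A i j)
    (hirr : ∀ i j, ∃ n : ℕ, 0 < (A ^ n) i j) :
    ∃ r : ℝ, 0 ≤ r ∧ ∃ x : ι → ℝ, (∀ i, 0 < x i) ∧ A *ᵥ x = r • x := by
  set M : ℝ := ∑ i, ∑ j, A i j
  have hbound : ∀ (r : ℝ) (x : ι → ℝ), x ∈ stdSimplex ℝ ι → (∀ i, r * x i ≤ (A *ᵥ x) i) →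
      r ≤ M := by
    intro r x hx h
    calc r = ∑ i, r * x i := by rw [← Finset.mul_sum, hx.2, mul_one]
      _ ≤ ∑ i, (A *ᵥ x) i := Finset.sum_le_sum fun i _ => h i
      _ ≤ M := by
        refine Finset.sum_le_sum fun i _ => Finset.sum_le_sum fun j _ => ?_
        refine mul_le_of_le_one_right (hA i j) ?_
        rw [← hx.2]
        exact Finset.single_le_sum (fun i _ => hx.1 i) (Finset.mem_univ j)
  let C : Set (ℝ × (ι → ℝ)) := (Set.Icc 0 M ×ˢ stdSimplex ℝ ι) ∩
    {p | ∀ i, p.1 * p.2 i ≤ (A *ᵥ p.2) i}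
  have hclosed : IsClosed {p : ℝ × (ι → ℝ) | ∀ i, p.1 * p.2 i ≤ (A *ᵥ p.2) i} := by
    simp only [Set.ofPred_forall]
    refine isClosed_iInter fun i => isClosed_le (by fun_prop) ?_
    simp only [Matrix.mulVec, dotProduct]
    fun_prop
  have hC : IsCompact C := (isCompact_Icc.prod (isCompact_stdSimplex ℝ ι)).inter_right hclosed
  have hne : C.Nonempty := by
    have hx := single_mem_stdSimplex ℝ (Classical.arbitrary ι)
    have h0 : ∀ i, 0 * Pi.single (M := fun _ => ℝ) (Classical.arbitrary ι) (1 : ℝ) i ≤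
        (A *ᵥ Pi.single (Classical.arbitrary ι) 1) i := fun i => by
      rw [zero_mul]
      exact Finset.sum_nonneg fun j _ => mul_nonneg (hA i j) (hx.1 j)
    exact ⟨(0, _), ⟨⟨le_rfl, hbound 0 _ hx h0⟩, hx⟩, h0⟩
  obtain ⟨⟨r, x⟩, ⟨⟨⟨hr0, -⟩, hx⟩, hsub⟩, hmax⟩ := hC.exists_isMaxOn hne continuous_fst.continuousOn
  simp only at hr0 hx hsub
  obtain ⟨N, hN⟩ := exists_sum_pow_apply_pos hA hirr
  set B := ∑ k ∈ Finset.range N, A ^ k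
  have hcomm : A * B = B * A :=
    (Commute.sum_right _ _ _ fun k _ => Commute.pow_right (Commute.refl A) k).eq
  have hx0 : x ≠ 0 := by rintro rfl; simpa using hx.2
  have hBx := mulVec_apply_pos hN hx.1 hx0
  have heig : A *ᵥ x = r • x := by
    by_contra hne
    have hd := mulVec_apply_pos hN (x := A *ᵥ x - r • x)
      (fun i => by simpa using hsub i) (sub_ne_zero.mpr hne)
    set y := B *ᵥ x
    have hdy : B *ᵥ (A *ᵥ x - r • x) = A *ᵥ y - r • y := by
      rw [Matrix.mulVec_sub, Matrix.mulVec_smul, Matrix.mulVec_mulVec, ← hcomm,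
        ← Matrix.mulVec_mulVec]
    rw [hdy] at hd
    obtain ⟨i₀, -, hi₀⟩ := Finset.exists_min_image Finset.univ
      (fun i => (A *ᵥ y - r • y) i / y i) Finset.univ_nonempty
    -- `ε` is the largest number that can be added to `r` without violating `r y ≤ A y`.
    set ε := (A *ᵥ y - r • y) i₀ / y i₀
    have hε : 0 < ε := div_pos (hd i₀) (hBx i₀)
    have hy : ∀ i, (r + ε) * y i ≤ (A *ᵥ y) i := fun i => by
      have := (le_div_iff₀ (hBx i)).mp (hi₀ i (Finset.mem_univ i))
      simp only [Pi.sub_apply, Pi.smul_apply, smul_eq_mul] at this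
      linarith
    have hs : 0 < ∑ i, y i := Finset.sum_pos (fun i _ => hBx i) Finset.univ_nonempty
    have hmem : (∑ i, y i)⁻¹ • y ∈ stdSimplex ℝ ι := by
      refine ⟨fun i => mul_nonneg (inv_nonneg.mpr hs.le) (hBx i).le, ?_⟩
      simp only [Pi.smul_apply, smul_eq_mul]
      rw [← Finset.mul_sum, inv_mul_cancel₀ hs.ne']
    have hsub' : ∀ i, (r + ε) * ((∑ i, y i)⁻¹ • y) i ≤ (A *ᵥ ((∑ i, y i)⁻¹ • y)) i := fun i => by
      rw [Matrix.mulVec_smul]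
      simp only [Pi.smul_apply, smul_eq_mul]
      calc _ = (∑ i, y i)⁻¹ * ((r + ε) * y i) := by ring
        _ ≤ _ := mul_le_mul_of_nonneg_left (hy i) (inv_nonneg.mpr hs.le)
    have : r + ε ≤ r := hmax (a := (r + ε, (∑ i, y i)⁻¹ • y))
      ⟨⟨⟨by linarith, hbound _ _ hmem hsub'⟩, hmem⟩, hsub'⟩
    linarith
  refine ⟨r, hr0, x, fun i => ?_, heig⟩
  have hBxi : B *ᵥ x = (∑ k ∈ Finset.range N, r ^ k) • x := by
    rw [Matrix.sum_mulVec, Finset.sum_smul]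
    exact Finset.sum_congr rfl fun k _ => pow_mulVec_eigen heig k
  have h := hBx i
  rw [hBxi, Pi.smul_apply, smul_eq_mul] at h
  exact pos_of_mul_pos_right h (Finset.sum_nonneg fun k _ => pow_nonneg hr0 k)

lemma mem_spectrum_iff_exists_mulVec {B : Matrix ι ι ℂ} {k : ℂ} :
    k ∈ spectrum ℂ B ↔ ∃ z ≠ 0, B *ᵥ z = k • z := by
  rw [← Matrix.spectrum_toLin', ← Module.End.hasEigenvalue_iff_mem_spectrum]
  constructor
  · intro h
    obtain ⟨z, hz⟩ := h.exists_hasEigenvector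
    exact ⟨z, hz.2, by simpa using hz.apply_eq_smul⟩
  · rintro ⟨z, hz, h⟩
    exact Module.End.hasEigenvalue_of_hasEigenvector
      (Module.End.hasEigenvector_iff.mpr ⟨Module.End.mem_eigenspace_iff.mpr (by simpa using h), hz⟩)

/-- If `A z = k z`, then `‖k‖ |z| ≤ A |z|`, and pairing with the positive left eigenvector `ν` gives
`‖k‖ ≤ r`; the right eigenvector shows that `r` itself lies in the spectrum. -/
theorem spectralRadius_eq_of_pos_eigenvectors [Nonempty ι] (hA : ∀ i j, 0 ≤ A i j) {r : ℝ}
    (hr : 0 ≤ r) {ν ξ : ι → ℝ} (hν : ∀ i, 0 < ν i) (hξ : ∀ i, 0 < ξ i)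
    (hνA : ν ᵥ* A = r • ν) (hAξ : A *ᵥ ξ = r • ξ) :
    (spectralRadius ℂ (A.map ((↑) : ℝ → ℂ))).toReal = r := by
  have hle : ∀ k ∈ spectrum ℂ (A.map ((↑) : ℝ → ℂ)), ‖k‖ ≤ r := by
    intro k hk
    obtain ⟨z, hz0, hz⟩ := mem_spectrum_iff_exists_mulVec.mp hk
    obtain ⟨j, hj⟩ := Function.ne_iff.mp hz0
    have hS : 0 < ∑ i, ν i * ‖z i‖ :=
      Finset.sum_pos' (fun i _ => mul_nonneg (hν i).le (norm_nonneg _))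
        ⟨j, Finset.mem_univ _, mul_pos (hν j) (norm_pos_iff.mpr hj)⟩
    refine le_of_mul_le_mul_right ?_ hS
    calc ‖k‖ * ∑ i, ν i * ‖z i‖ = ∑ i, ν i * ‖(k • z) i‖ := by
          rw [Finset.mul_sum]
          refine Finset.sum_congr rfl fun i _ => ?_
          rw [Pi.smul_apply, smul_eq_mul, norm_mul]; ring
      _ ≤ ∑ i, ν i * (A *ᵥ fun j => ‖z j‖) i := by
          refine Finset.sum_le_sum fun i _ => mul_le_mul_of_nonneg_left ?_ (hν i).le
          rw [← hz]
          refine (norm_sum_le _ _).trans_eq (Finset.sum_congr rfl fun j _ => ?_)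
          change ‖(A i j : ℂ) * z j‖ = A i j * ‖z j‖
          rw [norm_mul, Complex.norm_real, Real.norm_of_nonneg (hA i j)]
      _ = ν ⬝ᵥ (A *ᵥ fun j => ‖z j‖) := rfl
      _ = r * ∑ i, ν i * ‖z i‖ := by
          rw [Matrix.dotProduct_mulVec, hνA, smul_dotProduct, smul_eq_mul]; rfl
  have hmem : (r : ℂ) ∈ spectrum ℂ (A.map ((↑) : ℝ → ℂ)) := by
    refine mem_spectrum_iff_exists_mulVec.mpr ⟨fun i => (ξ i : ℂ), ?_, ?_⟩
    · intro h
      have := congrFun h (Classical.arbitrary ι)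
      simp only [Pi.zero_apply, Complex.ofReal_eq_zero] at this
      exact (hξ _).ne' this
    · ext i
      have := congrFun hAξ i
      simp only [Matrix.mulVec, dotProduct, Pi.smul_apply, smul_eq_mul, Matrix.map_apply] at this ⊢
      exact_mod_cast congrArg ((↑) : ℝ → ℂ) this
  have heq : spectralRadius ℂ (A.map ((↑) : ℝ → ℂ)) = ENNReal.ofReal r := by
    have hcoe : ∀ k : ℂ, (‖k‖₊ : ENNReal) = ENNReal.ofReal ‖k‖ := fun k =>
      (ofReal_norm k).symm
    refine le_antisymm (iSup₂_le fun k hk => ?_) ?_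
    · rw [hcoe]; exact ENNReal.ofReal_le_ofReal (hle k hk)
    · refine le_trans (le_of_eq ?_)
        (le_iSup₂ (f := fun (k : ℂ) (_ : k ∈ spectrum ℂ (A.map ((↑) : ℝ → ℂ))) =>
          (‖k‖₊ : ENNReal)) (r : ℂ) hmem)
      rw [hcoe, Complex.norm_real, Real.norm_of_nonneg hr]
  rw [heq, ENNReal.toReal_ofReal hr]

end NonnegMatrix

/-- The positive eigenvectors `x` of `Q` and `y` of its transpose have the same eigenvalue, since
`⟨y, Q x⟩ = ⟨Qᵀ y, x⟩` and `⟨y, x⟩ > 0`. -/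
theorem exists_isPerronPair {K : ℕ} [NeZero K] {Q : Matrix (Fin K) (Fin K) ℝ}
    (hQ : ∀ i j, 0 ≤ Q i j) (hirr : Irred Q) : ∃ ν ξ : Fin K → ℝ, IsPerronPair Q ν ξ := by
  have : Nonempty (Fin K) := ⟨0⟩
  obtain ⟨r, hr, x, hx, hQx⟩ := exists_pos_eigenvector hQ hirr
  obtain ⟨s, hs, y, hy, hyQ⟩ := exists_pos_eigenvector (A := Q.transpose) (fun i j => hQ j i)
    fun i j => by
      obtain ⟨n, hn⟩ := hirr j i
      exact ⟨n, by rwa [← Matrix.transpose_pow]⟩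
  rw [Matrix.mulVec_transpose] at hyQ
  have hxy : 0 < ∑ j, y j * x j := Finset.sum_pos (fun j _ => mul_pos (hy j) (hx j))
    Finset.univ_nonempty
  have hsr : s = r := by
    have h := Matrix.dotProduct_mulVec y Q x
    rw [hQx, hyQ, smul_dotProduct, dotProduct_smul, smul_eq_mul, smul_eq_mul] at h
    exact (mul_right_cancel₀ (b := y ⬝ᵥ x) hxy.ne' h).symm
  subst hsr
  have hspec : specRad Q = s := spectralRadius_eq_of_pos_eigenvectors hQ hs hy hx hyQ hQx
  have hsum : 0 < ∑ j, y j := Finset.sum_pos (fun j _ => hy j) Finset.univ_nonempty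
  refine ⟨(∑ j, y j)⁻¹ • y, ((∑ j, y j) * (∑ j, y j * x j)⁻¹) • x, ?_, ?_, ?_, ?_, ?_, ?_⟩
  · exact fun j => mul_pos (inv_pos.mpr hsum) (hy j)
  · exact fun j => mul_pos (mul_pos hsum (inv_pos.mpr hxy)) (hx j)
  · rw [Matrix.smul_vecMul, hyQ, hspec, smul_comm]
  · rw [Matrix.mulVec_smul, hQx, hspec, smul_comm]
  · simp only [Pi.smul_apply, smul_eq_mul]
    rw [← Finset.mul_sum, inv_mul_cancel₀ hsum.ne']
  · simp only [Pi.smul_apply, smul_eq_mul]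
    calc _ = ∑ j, (∑ j, y j * x j)⁻¹ * (y j * x j) := by
          refine Finset.sum_congr rfl fun j _ => ?_
          field_simp
      _ = 1 := by rw [← Finset.mul_sum, inv_mul_cancel₀ hxy.ne']

end QuasiErgodic

/-! ### Period and cyclic classes -/

namespace QuasiErgodic

section CyclicClasses

variable {K : ℕ} {Q : Matrix (Fin K) (Fin K) ℝ}

lemma period_dvd_of_pow_pos {x : Fin K} {n : ℕ} (h : 0 < (Q ^ n) x x) : period Q x ∣ n :=
  Nat.setGcd_dvd_of_mem h

lemma period_dvd_period (hQ : ∀ i j, 0 ≤ Q i j) (hirr : Irred Q) (x y : Fin K) :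
    period Q x ∣ period Q y := by
  obtain ⟨a, ha⟩ := hirr x y
  obtain ⟨b, hb⟩ := hirr y x
  refine Nat.dvd_setGcd_iff.mpr fun n hn => ?_
  have h₁ : period Q x ∣ a + b := period_dvd_of_pow_pos (pow_add_apply_pos hQ ha hb)
  have h₂ : period Q x ∣ a + n + b :=
    period_dvd_of_pow_pos (pow_add_apply_pos hQ (pow_add_apply_pos hQ ha hn) hb)
  rw [add_right_comm] at h₂
  exact (Nat.dvd_add_right h₁).mp h₂

theorem period_eq_period (hQ : ∀ i j, 0 ≤ Q i j) (hirr : Irred Q) (x y : Fin K) :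
    period Q x = period Q y :=
  Nat.dvd_antisymm (period_dvd_period hQ hirr x y) (period_dvd_period hQ hirr y x)

lemma exists_pos_pow_apply_self {x : Fin K} (hT : period Q x ≠ 0) :
    ∃ d, d ≠ 0 ∧ 0 < (Q ^ d) x x := by
  obtain ⟨d, hd, hd0⟩ := Nat.exists_ne_zero_of_setGcd_ne_zero hT
  exact ⟨d, hd0, hd⟩

/-- The recursive definition of the cyclic classes unfolded: `C_j` is reached from `o` at the times
`nT + j`, `n ≥ 1`. -/
lemma mem_cyclicClass_iff (hQ : ∀ i j, 0 ≤ Q i j) {o y : Fin K} {j : ℕ} :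
    y ∈ cyclicClass Q o j ↔ ∃ n : ℕ, 1 ≤ n ∧ 0 < (Q ^ (n * period Q o + j)) o y := by
  induction j generalizing y with
  | zero => rfl
  | succ j ih =>
    simp only [cyclicClass, Set.mem_ofPred_eq, ih, ← add_assoc, pow_succ_apply_pos_iff hQ]
    exact ⟨fun ⟨x, ⟨n, hn, h₁⟩, h₂⟩ => ⟨n, hn, x, h₁, h₂⟩,
      fun ⟨n, hn, x, h₁, h₂⟩ => ⟨x, ⟨n, hn, h₁⟩, h₂⟩⟩

lemma classIndex_mem (hQ : ∀ i j, 0 ≤ Q i j) (hirr : Irred Q) {o : Fin K} (hT : period Q o ≠ 0)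
    (y : Fin K) : y ∈ cyclicClass Q o (classIndex Q o y) := by
  refine Nat.sInf_mem (s := {j | y ∈ cyclicClass Q o j}) ?_
  obtain ⟨m, hm⟩ := hirr o y
  obtain ⟨d, hd0, hd⟩ := exists_pos_pow_apply_self hT
  obtain ⟨e, rfl⟩ := period_dvd_of_pow_pos hd
  -- Going round from `o` to `o` once before heading for `y` makes `n ≥ 1`.
  refine ⟨m, (mem_cyclicClass_iff hQ).mpr ⟨e, Nat.one_le_iff_ne_zero.mpr ?_, ?_⟩⟩
  · rintro rfl; simp at hd0
  · rw [mul_comm]; exact pow_add_apply_pos hQ hd hm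

lemma cast_classIndex_of_pow_pos (hQ : ∀ i j, 0 ≤ Q i j) (hirr : Irred Q) {o : Fin K}
    (hT : period Q o ≠ 0) {y : Fin K} {m : ℕ} (hm : 0 < (Q ^ m) o y) :
    (classIndex Q o y : ZMod (period Q o)) = m := by
  obtain ⟨n, -, hn⟩ := (mem_cyclicClass_iff hQ).mp (classIndex_mem hQ hirr hT y)
  obtain ⟨b, hb⟩ := hirr y o
  have h₁ := (ZMod.natCast_eq_zero_iff _ _).mpr (period_dvd_of_pow_pos (pow_add_apply_pos hQ hm hb))
  have h₂ := (ZMod.natCast_eq_zero_iff _ _).mpr (period_dvd_of_pow_pos (pow_add_apply_pos hQ hn hb))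
  push_cast at h₁ h₂
  rw [ZMod.natCast_self, mul_zero, zero_add] at h₂
  exact add_right_cancel (h₂.trans h₁.symm)

/-- Modulo the period, `classIndex` counts steps: each step of `Q` raises it by one. -/
theorem cast_classIndex_eq_add (hQ : ∀ i j, 0 ≤ Q i j) (hirr : Irred Q) {o : Fin K}
    (hT : period Q o ≠ 0) {x y : Fin K} {n : ℕ} (h : 0 < (Q ^ n) x y) :
    (classIndex Q o y : ZMod (period Q o)) = classIndex Q o x + n := by
  obtain ⟨m, hm⟩ := hirr o x
  rw [cast_classIndex_of_pow_pos hQ hirr hT hm,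
    cast_classIndex_of_pow_pos hQ hirr hT (pow_add_apply_pos hQ hm h), Nat.cast_add]

/-- Primitivity along the cycle. The return times to `o` form an additive monoid, which contains all
large multiples of its greatest common divisor; one exponent therefore serves every pair of states
whose classes allow it. -/
theorem exists_forall_pow_apply_pos (hQ : ∀ i j, 0 ≤ Q i j) (hirr : Irred Q) {o : Fin K}
    (hT : period Q o ≠ 0) : ∃ N : ℕ, ∀ x y : Fin K,
      (classIndex Q o y : ZMod (period Q o)) = classIndex Q o x + N → 0 < (Q ^ N) x y := by
  obtain ⟨M, hM⟩ := Nat.exists_mem_closure_of_ge {n : ℕ | 0 < (Q ^ n) o o}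
  have hclosure : ∀ m ≥ M, period Q o ∣ m → 0 < (Q ^ m) o o := fun m hm hdvd =>
    AddSubmonoid.closure_induction (motive := fun m _ => 0 < (Q ^ m) o o) (fun _ h => h) (by simp)
      (fun _ _ _ _ h₁ h₂ => pow_add_apply_pos hQ h₁ h₂) (hM m hm hdvd)
  choose a ha using fun x => hirr x o
  choose b hb using fun y => hirr o y
  refine ⟨M + ∑ x, a x + ∑ y, b y, fun x y hxy => ?_⟩
  have hax : a x ≤ ∑ x, a x := Finset.single_le_sum (fun _ _ => Nat.zero_le _) (Finset.mem_univ x)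
  have hby : b y ≤ ∑ y, b y := Finset.single_le_sum (fun _ _ => Nat.zero_le _) (Finset.mem_univ y)
  obtain ⟨m, hm⟩ : ∃ m, M + ∑ x, a x + ∑ y, b y = a x + m + b y :=
    ⟨M + ∑ x, a x + ∑ y, b y - a x - b y, by omega⟩
  rw [hm] at hxy ⊢
  have hdvd : period Q o ∣ m := by
    have h := cast_classIndex_eq_add (o := o) hQ hirr hT (pow_add_apply_pos hQ (ha x) (hb y))
    rw [hxy] at h
    push_cast at h
    refine (ZMod.natCast_eq_zero_iff _ _).mp ?_
    linear_combination h
  exact pow_add_apply_pos hQ (pow_add_apply_pos hQ (ha x) (hclosure m (by omega) hdvd)) (hb y)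

end CyclicClasses

end QuasiErgodic

/-! ### Convergence of periodic chains -/

namespace QuasiErgodic

section CyclicChain

open Matrix Topology

variable {ι : Type*} [Fintype ι] {T : ℕ}

/-- The mean of `h` over the class `c = a`, with respect to the probability vector `π`, each class
being assumed to have mass `1 / T`. -/
noncomputable def classMean (c : ι → ZMod T) (π : ι → ℝ) (h : ι → ℝ) (a : ZMod T) : ℝ :=
  T * ∑ y, if c y = a then π y * h y else 0

lemma classMean_sub (c : ι → ZMod T) (π g h : ι → ℝ) (a : ZMod T) :
    classMean c π (g - h) a = classMean c π g a - classMean c π h a := by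
  simp only [classMean, ← mul_sub, ← Finset.sum_sub_distrib]
  congr 1
  refine Finset.sum_congr rfl fun y _ => ?_
  split_ifs
  · rw [Pi.sub_apply, mul_sub]
  · rw [sub_zero]

lemma sum_classMean [NeZero T] (c : ι → ZMod T) (π h : ι → ℝ) :
    ∑ a, classMean c π h a = T * ∑ y, π y * h y := by
  simp only [classMean, ← Finset.mul_sum]
  rw [Finset.sum_comm]
  simp

variable [DecidableEq ι]

/-- `R` is a stochastic matrix with positive invariant probability vector `π`, each step of which
raises the class `c` by one, and some power of which charges every transition that the classes
allow. -/
structure IsCyclicChain (R : Matrix ι ι ℝ) (π : ι → ℝ) (c : ι → ZMod T) : Prop where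
  nonneg : ∀ x y, 0 ≤ R x y
  sum_row : ∀ x, ∑ y, R x y = 1
  pos : ∀ x, 0 < π x
  stationary : π ᵥ* R = π
  sum_eq_one : ∑ x, π x = 1
  step : ∀ x y, R x y ≠ 0 → c y = c x + 1
  mixing : ∃ N : ℕ, ∀ x y, c y = c x + N → 0 < (R ^ N) x y

namespace IsCyclicChain

variable {R : Matrix ι ι ℝ} {π : ι → ℝ} {c : ι → ZMod T}

/-- A function of the class factors out of `R ^ n`, since the class after `n` steps is known. -/
lemma pow_mulVec_comp_mul (H : IsCyclicChain R π c) (G : ZMod T → ℝ) (f : ι → ℝ) (n : ℕ) (x : ι) :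
    ((R ^ n) *ᵥ fun y => f y * G (c y)) x = G (c x + n) * ((R ^ n) *ᵥ f) x := by
  induction n generalizing x with
  | zero => simp [mul_comm]
  | succ n ih =>
    rw [pow_succ', ← Matrix.mulVec_mulVec, ← Matrix.mulVec_mulVec]
    simp only [Matrix.mulVec, dotProduct] at ih ⊢
    rw [Finset.mul_sum]
    refine Finset.sum_congr rfl fun y _ => ?_
    by_cases h : R x y = 0
    · rw [h, zero_mul, zero_mul, mul_zero]
    · rw [ih, H.step x y h]
      push_cast
      rw [add_right_comm, add_assoc]
      ring

lemma pow_sum_row (H : IsCyclicChain R π c) (n : ℕ) (x : ι) : ∑ y, (R ^ n) x y = 1 := by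
  have h : R *ᵥ (fun _ => 1) = (1 : ℝ) • fun _ => 1 := by
    ext x
    simpa [Matrix.mulVec, dotProduct] using H.sum_row x
  simpa [Matrix.mulVec, dotProduct] using congrFun (pow_mulVec_eigen h n) x

lemma abs_pow_mulVec_le (H : IsCyclicChain R π c) (n : ℕ) (d : ι → ℝ) (x : ι) :
    |((R ^ n) *ᵥ d) x| ≤ ‖d‖ := by
  calc |∑ y, (R ^ n) x y * d y| ≤ ∑ y, |(R ^ n) x y * d y| := Finset.abs_sum_le_sum_abs _ _
    _ ≤ ∑ y, (R ^ n) x y * ‖d‖ := by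
        refine Finset.sum_le_sum fun y _ => ?_
        rw [abs_mul, abs_of_nonneg (pow_apply_nonneg H.nonneg n x y)]
        exact mul_le_mul_of_nonneg_left (norm_le_pi_norm d y) (pow_apply_nonneg H.nonneg n x y)
    _ = ‖d‖ := by rw [← Finset.sum_mul, H.pow_sum_row, one_mul]

lemma classMean_mulVec (H : IsCyclicChain R π c) (h : ι → ℝ) (a : ZMod T) :
    classMean c π (R *ᵥ h) a = classMean c π h (a + 1) := by
  simp only [classMean]
  congr 1
  calc ∑ z, (if c z = a then π z * (R *ᵥ h) z else 0)
      = ∑ z, ∑ y, if c y = a + 1 then π z * R z y * h y else 0 := by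
        refine Finset.sum_congr rfl fun z _ => ?_
        have hzy : ∀ y, (if c y = a + 1 then π z * R z y * h y else 0) =
            if c z = a then π z * (R z y * h y) else 0 := fun y => by
          by_cases hR : R z y = 0
          · simp [hR]
          · rw [H.step z y hR]
            simp only [add_left_inj, mul_assoc]
        simp only [hzy]
        split_ifs
        · rw [← Finset.mul_sum]; rfl
        · simp
    _ = ∑ y, if c y = a + 1 then π y * h y else 0 := by
        rw [Finset.sum_comm]
        refine Finset.sum_congr rfl fun y _ => ?_
        split_ifs
        · rw [← Finset.sum_mul]
          exact congrArg (· * h y) (congrFun H.stationary y)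
        · simp

lemma classMean_pow_mulVec (H : IsCyclicChain R π c) (h : ι → ℝ) (n : ℕ) (a : ZMod T) :
    classMean c π ((R ^ n) *ᵥ h) a = classMean c π h (a + n) := by
  induction n generalizing a with
  | zero => simp
  | succ n ih =>
    rw [pow_succ', ← Matrix.mulVec_mulVec, H.classMean_mulVec, ih, Nat.cast_succ, add_assoc,
      add_comm 1]

/-- All classes have the same mass, since the chain moves each onto the next. -/
lemma classMean_one [NeZero T] (H : IsCyclicChain R π c) (a : ZMod T) : classMean c π 1 a = 1 := by
  have hR : R *ᵥ 1 = 1 := by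
    ext x
    simpa [Matrix.mulVec, dotProduct] using H.sum_row x
  have hconst : ∀ n : ℕ, classMean c π 1 (n : ZMod T) = classMean c π 1 0 := by
    intro n
    induction n with
    | zero => simp
    | succ n ih => rw [Nat.cast_succ, ← H.classMean_mulVec, hR, ih]
  have hall : ∀ b : ZMod T, classMean c π 1 b = classMean c π 1 0 := fun b => by
    rw [← hconst b.val, ZMod.natCast_zmod_val]
  have hsum := sum_classMean c π (1 : ι → ℝ)
  simp only [hall, Pi.one_apply, mul_one, H.sum_eq_one, Finset.sum_const, Finset.card_univ,
    ZMod.card, nsmul_eq_mul] at hsum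
  have hT : (T : ℝ) ≠ 0 := Nat.cast_ne_zero.mpr (NeZero.ne T)
  rw [hall a]
  exact mul_left_cancel₀ hT (hsum.trans (mul_one _).symm)

lemma classMean_comp [NeZero T] (H : IsCyclicChain R π c) (G : ZMod T → ℝ) (a : ZMod T) :
    classMean c π (fun y => G (c y)) a = G a := by
  have h := H.classMean_one a
  simp only [classMean, Pi.one_apply, mul_one] at h ⊢
  calc _ = T * ∑ y, (if c y = a then π y else 0) * G a := by
        congr 1
        refine Finset.sum_congr rfl fun y _ => ?_
        split_ifs with hy
        · rw [hy]
        · rw [zero_mul]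
    _ = G a := by rw [← Finset.sum_mul, ← mul_assoc, h, one_mul]

/-- A Doeblin condition along the cycle: some power of `R` is a strict contraction, in the maximum
norm, of the vectors whose mean over each class vanishes. -/
lemma exists_contraction [NeZero T] (H : IsCyclicChain R π c) :
    ∃ (N : ℕ) (q : ℝ), q < 1 ∧ ∀ d : ι → ℝ, (∀ a, classMean c π d a = 0) →
      ‖(R ^ N) *ᵥ d‖ ≤ q * ‖d‖ := by
  have hT : (0 : ℝ) < T := Nat.cast_pos.mpr (NeZero.pos T)
  obtain ⟨N, hN⟩ := H.mixing
  have hι : Nonempty ι := by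
    by_contra hι
    rw [not_nonempty_iff] at hι
    simpa using H.sum_eq_one
  obtain ⟨p, hp⟩ := Finite.exists_min fun p : ι × ι =>
    if c p.2 = c p.1 + N then (R ^ N) p.1 p.2 else 1
  obtain ⟨δ, hδ, hle⟩ : ∃ δ : ℝ, 0 < δ ∧ ∀ x y, c y = c x + N → δ ≤ (R ^ N) x y := by
    refine ⟨_, ?_, fun x y hxy => (hp (x, y)).trans_eq (if_pos hxy)⟩
    split_ifs with h
    · exact hN _ _ h
    · exact one_pos
  have hπ : ∀ y, π y ≤ 1 := fun y => by
    rw [← H.sum_eq_one]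
    exact Finset.single_le_sum (fun z _ => (H.pos z).le) (Finset.mem_univ y)
  -- The matrix `S` is what remains of `R ^ N` after removing the multiple `δ / T` of the projection
  -- onto class means, which kills `d`.
  let S : ι → ι → ℝ := fun x y => (R ^ N) x y - if c y = c x + N then δ * π y else 0
  have hS : ∀ x y, 0 ≤ S x y := fun x y => by
    by_cases h : c y = c x + N
    · simp only [S, if_pos h, sub_nonneg]
      exact (mul_le_of_le_one_right hδ.le (hπ y)).trans (hle x y h)
    · simpa only [S, if_neg h, sub_zero] using pow_apply_nonneg H.nonneg N x y
  have hsum : ∀ (d : ι → ℝ) (x : ι), ∑ y, S x y * d y =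
      ((R ^ N) *ᵥ d) x - δ / T * classMean c π d (c x + N) := fun d x => by
    simp only [S, classMean, Matrix.mulVec, dotProduct]
    rw [← mul_assoc, div_mul_cancel₀ _ hT.ne', Finset.mul_sum, ← Finset.sum_sub_distrib]
    refine Finset.sum_congr rfl fun y _ => ?_
    split_ifs <;> ring
  have hS1 : ∀ x, ∑ y, S x y = 1 - δ / T := fun x => by
    have h := hsum 1 x
    rw [H.classMean_one] at h
    simpa [Matrix.mulVec, dotProduct, H.pow_sum_row] using h
  have hq : 0 ≤ 1 - δ / T := by
    rw [← hS1 (Classical.arbitrary ι)]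
    exact Finset.sum_nonneg fun y _ => hS _ y
  refine ⟨N, 1 - δ / T, by linarith [div_pos hδ hT], fun d hd => ?_⟩
  refine (pi_norm_le_iff_of_nonneg (mul_nonneg hq (norm_nonneg d))).mpr fun x => ?_
  have h := hsum d x
  rw [hd, mul_zero, sub_zero] at h
  rw [← h, Real.norm_eq_abs, ← hS1 x, Finset.sum_mul]
  refine (Finset.abs_sum_le_sum_abs _ _).trans (Finset.sum_le_sum fun y _ => ?_)
  rw [abs_mul, abs_of_nonneg (hS x y)]
  exact mul_le_mul_of_nonneg_left (norm_le_pi_norm d y) (hS x y)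

/-- The convergence theorem for a periodic chain. The differences `d n` have vanishing class means
and satisfy `R ^ m d n = d (m + n)`, so their norms decrease, and by a fixed factor every `N` steps.
-/
theorem tendsto_norm_pow_mulVec_sub [NeZero T] (H : IsCyclicChain R π c) (h : ι → ℝ) :
    Tendsto (fun n : ℕ => ‖(R ^ n) *ᵥ h - fun x => classMean c π h (c x + n)‖) atTop (𝓝 0) := by
  set d : ℕ → ι → ℝ := fun n => (R ^ n) *ᵥ h - fun x => classMean c π h (c x + n)
  have hd : ∀ m n, (R ^ m) *ᵥ d n = d (m + n) := fun m n => by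
    ext x
    have h₁ := H.pow_mulVec_comp_mul (fun a => classMean c π h (a + n)) 1 m x
    have h₂ : ((R ^ m) *ᵥ (1 : ι → ℝ)) x = 1 := by
      simpa [Matrix.mulVec, dotProduct] using H.pow_sum_row m x
    simp only [Pi.one_apply, one_mul, h₂, mul_one] at h₁
    simp only [d, Matrix.mulVec_sub, Matrix.mulVec_mulVec, ← pow_add, Pi.sub_apply, h₁]
    push_cast
    rw [add_assoc]
  have hmean : ∀ n a, classMean c π (d n) a = 0 := fun n a => by
    simp only [d]
    rw [classMean_sub, H.classMean_pow_mulVec,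
      H.classMean_comp (fun b => classMean c π h (b + n)), sub_self]
  have hanti : Antitone fun n => ‖d n‖ := antitone_nat_of_succ_le fun n => by
    rw [add_comm, ← hd 1 n]
    exact (pi_norm_le_iff_of_nonneg (norm_nonneg _)).mpr fun x => H.abs_pow_mulVec_le 1 (d n) x
  have hlim := tendsto_atTop_ciInf hanti ⟨0, by rintro _ ⟨n, rfl⟩; exact norm_nonneg _⟩
  set L := ⨅ n, ‖d n‖
  obtain ⟨N, q, hq, hcontr⟩ := H.exists_contraction
  have hL0 : 0 ≤ L := ge_of_tendsto' hlim fun n => norm_nonneg _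
  have hLq : L ≤ q * L := by
    refine le_of_tendsto_of_tendsto' (hlim.comp (tendsto_add_atTop_nat N)) (hlim.const_mul q) ?_
    intro n
    simp only [Function.comp_apply]
    rw [add_comm, ← hd]
    exact hcontr _ (hmean n)
  have hL : L = 0 := by nlinarith
  rwa [hL] at hlim

end IsCyclicChain

lemma sum_range_zmod [NeZero T] (v : ZMod T → ℝ) (a : ZMod T) :
    ∑ k ∈ Finset.range T, v (a + k) = ∑ b, v b := by
  refine Finset.sum_nbij (fun k : ℕ => a + (k : ZMod T)) (fun _ _ => Finset.mem_univ _) ?_ ?_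
    fun _ _ => rfl
  · intro k hk l hl hkl
    have h := (ZMod.natCast_eq_natCast_iff' k l T).mp (add_left_cancel hkl)
    rwa [Nat.mod_eq_of_lt (by simpa using hk), Nat.mod_eq_of_lt (by simpa using hl)] at h
  · intro b _
    exact ⟨(b - a).val, by simpa using ZMod.val_lt (b - a), by simp⟩

/-- The time average of a periodic sequence: the centred partial sums are periodic, hence
bounded. -/
lemma tendsto_cesaro_zmod [NeZero T] (u : ZMod T → ℝ) (a : ZMod T) :
    Tendsto (fun n : ℕ => (n : ℝ)⁻¹ * ∑ k ∈ Finset.range n, u (a + k)) atTop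
      (𝓝 ((T : ℝ)⁻¹ * ∑ b, u b)) := by
  have hT : (T : ℝ) ≠ 0 := Nat.cast_ne_zero.mpr (NeZero.ne T)
  set m := (T : ℝ)⁻¹ * ∑ b, u b
  set S : ℕ → ℝ := fun n => ∑ k ∈ Finset.range n, (u (a + k) - m)
  have hper : Function.Periodic S T := fun n => by
    have h := sum_range_zmod (fun b => u b - m) (a + n)
    have h0 : ∑ b, (u b - m) = 0 := by
      rw [Finset.sum_sub_distrib, Finset.sum_const, Finset.card_univ, ZMod.card, nsmul_eq_mul,
        mul_inv_cancel_left₀ hT, sub_self]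
    simp only [S, Finset.sum_range_add, Nat.cast_add, ← add_assoc, h, h0, add_zero]
  have hbdd : ∀ n, |S n| ≤ ∑ k ∈ Finset.range T, |S k| := fun n => by
    rw [← hper.map_mod_nat n]
    exact Finset.single_le_sum (f := fun k => |S k|) (fun _ _ => abs_nonneg _)
      (Finset.mem_range.mpr (Nat.mod_lt n (NeZero.pos T)))
  have hS : Tendsto (fun n : ℕ => (n : ℝ)⁻¹ * S n) atTop (𝓝 0) := by
    refine squeeze_zero_norm (a := fun n : ℕ => (n : ℝ)⁻¹ * ∑ k ∈ Finset.range T, |S k|)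
      (fun n => ?_) ?_
    · rw [norm_mul, Real.norm_eq_abs, Real.norm_eq_abs, abs_of_nonneg (by positivity)]
      exact mul_le_mul_of_nonneg_left (hbdd n) (by positivity)
    · simpa using (tendsto_inv_atTop_nhds_zero_nat (𝕜 := ℝ)).mul_const (∑ k ∈ Finset.range T, |S k|)
  have heq : ∀ᶠ n : ℕ in atTop,
      (n : ℝ)⁻¹ * S n + m = (n : ℝ)⁻¹ * ∑ k ∈ Finset.range n, u (a + k) := by
    filter_upwards [eventually_ne_atTop 0] with n hn
    have hn' : (n : ℝ) ≠ 0 := Nat.cast_ne_zero.mpr hn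
    simp only [S, Finset.sum_sub_distrib, Finset.sum_const, Finset.card_range, nsmul_eq_mul]
    field_simp
    ring
  simpa using (hS.add_const m).congr' heq

namespace IsCyclicChain

variable {R : Matrix ι ι ℝ} {π : ι → ℝ} {c : ι → ZMod T}

/-- The ergodic theorem: the periodic fluctuations of `R ^ k` average out. -/
lemma tendsto_cesaro_pow_mulVec [NeZero T] (H : IsCyclicChain R π c) (f : ι → ℝ) (x : ι) :
    Tendsto (fun n : ℕ => (n : ℝ)⁻¹ * ∑ k ∈ Finset.range n, ((R ^ k) *ᵥ f) x) atTop
      (𝓝 (∑ y, π y * f y)) := by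
  have hT : (T : ℝ) ≠ 0 := Nat.cast_ne_zero.mpr (NeZero.ne T)
  have h₁ : Tendsto (fun n : ℕ => ((R ^ n) *ᵥ f) x - classMean c π f (c x + n)) atTop (𝓝 0) :=
    squeeze_zero_norm (fun n => norm_le_pi_norm
      ((R ^ n) *ᵥ f - fun x => classMean c π f (c x + n)) x) (H.tendsto_norm_pow_mulVec_sub f)
  have h₂ := h₁.cesaro.add (tendsto_cesaro_zmod (classMean c π f) (c x))
  rw [sum_classMean, inv_mul_cancel_left₀ hT, zero_add] at h₂
  refine h₂.congr fun n => ?_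
  rw [← mul_add, ← Finset.sum_add_distrib]
  simp

/-- A two-sided ergodic theorem: the weight `f`, seen at a uniform time in `[0, n)`, averages out to
its invariant mean, independently of the payoff `h` at time `n`. -/
theorem tendsto_cesaro_two_sided [NeZero T] (H : IsCyclicChain R π c) (f h : ι → ℝ) (x : ι) :
    Tendsto (fun n : ℕ => (n : ℝ)⁻¹ * ∑ k ∈ Finset.range n,
        ((R ^ k) *ᵥ fun z => f z * ((R ^ (n - k)) *ᵥ h) z) x -
          (∑ y, π y * f y) * classMean c π h (c x + n)) atTop (𝓝 0) := by
  set g := classMean c π h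
  set d : ℕ → ι → ℝ := fun n => (R ^ n) *ᵥ h - fun x => g (c x + n)
  -- The part of `R ^ (n - k) h` that has not yet converged contributes nothing on average.
  have hrem : Tendsto (fun n : ℕ => (n : ℝ)⁻¹ * ∑ k ∈ Finset.range n,
      ((R ^ k) *ᵥ fun z => f z * d (n - k) z) x) atTop (𝓝 0) := by
    have hd : Tendsto (fun n : ℕ => ‖f‖ * ‖d (n + 1)‖) atTop (𝓝 0) := by
      have h₁ := ((H.tendsto_norm_pow_mulVec_sub h).comp (tendsto_add_atTop_nat 1)).const_mul ‖f‖
      rwa [mul_zero] at h₁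
    refine squeeze_zero_norm (fun n => ?_) hd.cesaro
    rw [norm_mul, Real.norm_eq_abs, Real.norm_eq_abs, abs_of_nonneg (by positivity)]
    refine mul_le_mul_of_nonneg_left ((Finset.abs_sum_le_sum_abs _ _).trans ?_) (by positivity)
    rw [← Finset.sum_range_reflect]
    refine Finset.sum_le_sum fun k hk => (H.abs_pow_mulVec_le _ _ _).trans ?_
    have hk' : n - (n - 1 - k) = k + 1 := by have := Finset.mem_range.mp hk; omega
    rw [hk']
    exact norm_mul_le f (d (k + 1))
  -- In the main part the class after `n` steps does not depend on `k` and factors out.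
  have hmain : ∀ n : ℕ, (n : ℝ)⁻¹ * ∑ k ∈ Finset.range n,
      ((R ^ k) *ᵥ fun z => f z * ((R ^ (n - k)) *ᵥ h) z) x =
        (n : ℝ)⁻¹ * ∑ k ∈ Finset.range n, ((R ^ k) *ᵥ fun z => f z * d (n - k) z) x +
          ((n : ℝ)⁻¹ * ∑ k ∈ Finset.range n, ((R ^ k) *ᵥ f) x) * g (c x + n) := fun n => by
    rw [mul_assoc, ← mul_add, Finset.sum_mul, ← Finset.sum_add_distrib]
    congr 1
    refine Finset.sum_congr rfl fun k hk => ?_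
    have h₁ := H.pow_mulVec_comp_mul (fun a => g (a + (n - k : ℕ))) f k x
    have hk' : c x + k + (n - k : ℕ) = c x + n := by
      rw [add_assoc, ← Nat.cast_add, Nat.add_sub_cancel' (Finset.mem_range.mp hk).le]
    simp only [hk'] at h₁
    rw [mul_comm _ (g _), ← h₁, ← Pi.add_apply, ← Matrix.mulVec_add]
    congr 2
    ext z
    simp only [d, Pi.add_apply, Pi.sub_apply]
    ring
  obtain ⟨C, hC⟩ : ∃ C, ∀ a, |g a| ≤ C :=
    ⟨∑ a, |g a|, fun a => Finset.single_le_sum (f := fun a => |g a|) (fun _ _ => abs_nonneg _)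
      (Finset.mem_univ a)⟩
  have herg : Tendsto (fun n : ℕ => ((n : ℝ)⁻¹ * ∑ k ∈ Finset.range n, ((R ^ k) *ᵥ f) x -
      ∑ y, π y * f y) * g (c x + n)) atTop (𝓝 0) := by
    have h0 := (H.tendsto_cesaro_pow_mulVec f x).sub_const (∑ y, π y * f y)
    rw [sub_self] at h0
    have h1 := h0.abs.mul_const C
    rw [abs_zero, zero_mul] at h1
    refine squeeze_zero_norm (fun n => ?_) h1
    rw [Real.norm_eq_abs, abs_mul]
    exact mul_le_mul_of_nonneg_left (hC _) (abs_nonneg _)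
  have := hrem.add herg
  rw [zero_add] at this
  refine this.congr fun n => ?_
  rw [hmain]
  ring

end IsCyclicChain

end CyclicChain

end QuasiErgodic

/-! ### The killed mean as a matrix expression -/

namespace QuasiErgodic

section MarkovProperty

open Matrix

variable {S Ω : Type*} [Fintype S] [MeasurableSpace S] [DiscreteMeasurableSpace S]
  [MeasurableSpace Ω] {μ : Measure Ω} {Y : ℕ → Ω → S}

lemma integrable_comp [IsProbabilityMeasure μ] (hY : ∀ n, Measurable (Y n)) (g : S → ℝ) (n : ℕ) :
    Integrable (fun ω => g (Y n ω)) μ :=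
  .of_bound ((Measurable.of_discrete (f := g)).comp (hY n)).aestronglyMeasurable ‖g‖
    (ae_of_all _ fun ω => norm_le_pi_norm g (Y n ω))

lemma measurableSet_path (hY : ∀ n, Measurable (Y n)) {n : ℕ} (a : Fin (n + 1) → S) :
    MeasurableSet {ω | ∀ i : Fin (n + 1), Y i ω = a i} := by
  simp only [Set.ofPred_forall]
  exact MeasurableSet.iInter fun i => hY i (measurableSet_singleton (a i))

/-- Functions of the history `Y₀, …, Yₙ` are finite combinations of indicators of path events. -/
lemma integral_history_mul (hY : ∀ n, Measurable (Y n)) {n : ℕ} (G : (Fin (n + 1) → S) → ℝ)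
    {φ : Ω → ℝ} (hφ : Integrable φ μ) :
    ∫ ω, G (fun i => Y i ω) * φ ω ∂μ =
      ∑ a, G a * ∫ ω in {ω | ∀ i : Fin (n + 1), Y i ω = a i}, φ ω ∂μ := by
  classical
  have hpt : ∀ ω, G (fun i => Y i ω) * φ ω =
      ∑ a, G a * {ω | ∀ i : Fin (n + 1), Y i ω = a i}.indicator φ ω := fun ω => by
    rw [Finset.sum_eq_single (fun i : Fin (n + 1) => Y i ω)]
    · rw [Set.indicator_of_mem]
      intro i; rfl
    · intro a _ ha
      rw [Set.indicator_of_notMem, mul_zero]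
      exact fun h => ha (funext fun i => (h i).symm)
    · simp
  simp only [hpt]
  rw [integral_finsetSum _ fun a _ => (hφ.indicator (measurableSet_path hY a)).const_mul _]
  refine Finset.sum_congr rfl fun a _ => ?_
  rw [integral_const_mul, integral_indicator (measurableSet_path hY a)]

/-- The Markov property in integrated form: `P g` is the conditional mean of `g(Yₙ₊₁)` given the
history. -/
theorem IsMarkovChainFrom.integral_history_mul_next [IsProbabilityMeasure μ] {P : Matrix S S ℝ}
    (hP : ∀ i j, 0 ≤ P i j) {x : S} (H : IsMarkovChainFrom P x μ Y) {n : ℕ}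
    (G : (Fin (n + 1) → S) → ℝ) (g : S → ℝ) :
    ∫ ω, G (fun i => Y i ω) * g (Y (n + 1) ω) ∂μ =
      ∫ ω, G (fun i => Y i ω) * (P *ᵥ g) (Y n ω) ∂μ := by
  classical
  have hY := H.measurable
  rw [integral_history_mul hY G (integrable_comp hY g (n + 1)),
    integral_history_mul hY G (integrable_comp hY (P *ᵥ g) n)]
  refine Finset.sum_congr rfl fun a _ => congrArg (G a * ·) ?_
  have hE := measurableSet_path hY a
  set E := {ω | ∀ i : Fin (n + 1), Y i ω = a i}
  have hright : ∫ ω in E, (P *ᵥ g) (Y n ω) ∂μ = μ.real E * (P *ᵥ g) (a (Fin.last n)) := by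
    have hlast : Set.EqOn (fun ω => (P *ᵥ g) (Y n ω)) (fun _ => (P *ᵥ g) (a (Fin.last n))) E :=
      fun ω hω => congrArg (P *ᵥ g) (hω (Fin.last n))
    rw [setIntegral_congr_fun hE hlast, setIntegral_const, smul_eq_mul]
  have hpath : ∀ w, μ.real (E ∩ {ω | Y (n + 1) ω = w}) = μ.real E * P (a (Fin.last n)) w := by
    intro w
    -- The path `a` followed by `w`; its values beyond time `n + 1` do not matter.
    let b : ℕ → S := fun k => if h : k < n + 1 then a ⟨k, h⟩ else w
    have hb : ∀ i : Fin (n + 1), b i = a i := fun i => dif_pos i.2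
    have hw : b (n + 1) = w := dif_neg (lt_irrefl _)
    have h₁ : {ω | ∀ k ≤ n, Y k ω = b k} = E := by
      ext ω
      exact ⟨fun h i => (h i (Nat.lt_succ_iff.mp i.2)).trans (hb i),
        fun h k hk => (h ⟨k, Nat.lt_succ_of_le hk⟩).trans (hb ⟨k, Nat.lt_succ_of_le hk⟩).symm⟩
    have h₂ : {ω | ∀ k ≤ n + 1, Y k ω = b k} = E ∩ {ω | Y (n + 1) ω = w} := by
      rw [← h₁]
      ext ω
      simp only [Set.mem_ofPred_eq, Set.mem_inter_iff, ← hw]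
      exact ⟨fun h => ⟨fun k hk => h k (Nat.le_succ_of_le hk), h _ le_rfl⟩,
        fun h k hk => (Nat.le_succ_iff.mp hk).elim (h.1 k) fun hk => hk ▸ h.2⟩
    have hm := H.markov n b
    rw [h₁, h₂, hw] at hm
    rw [measureReal_def, hm, ENNReal.toReal_mul, ENNReal.toReal_ofReal (hP _ _)]
    exact congrArg (fun y => μ.real E * P y w) (hb (Fin.last n))
  have hpt : ∀ ω, g (Y (n + 1) ω) = ∑ w, {ω | Y (n + 1) ω = w}.indicator (fun _ => g w) ω := by
    intro ω
    simp [Set.indicator_apply]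
  have hms : ∀ w, MeasurableSet {ω | Y (n + 1) ω = w} := fun w =>
    hY (n + 1) (measurableSet_singleton w)
  simp only [hpt]
  rw [integral_finsetSum _ fun w _ => (integrable_const (g w)).indicator (hms w), hright]
  simp only [Matrix.mulVec, dotProduct]
  rw [Finset.mul_sum]
  refine Finset.sum_congr rfl fun w _ => ?_
  rw [integral_indicator_const _ (hms w), measureReal_restrict_apply (hms w), Set.inter_comm, hpath,
    smul_eq_mul, mul_assoc]

end MarkovProperty

section Killing

open Matrix

variable {K : ℕ} {Ω : Type*}

lemma lt_absorptionTime_iff {Y : ℕ → Ω → Fin (K + 1)} {n : ℕ} {ω : Ω} :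
    (n : ℕ∞) < absorptionTime Y ω ↔ ∀ k ≤ n, Y k ω ≠ 0 := by
  rw [← not_iff_not, not_lt, absorptionTime]
  push Not
  constructor
  · intro h
    have hlt : ⨅ m : {m : ℕ // Y m ω = 0}, ((m : ℕ) : ℕ∞) < ((n + 1 : ℕ) : ℕ∞) :=
      h.trans_lt (by exact_mod_cast Nat.lt_succ_self n)
    obtain ⟨m, hm⟩ := iInf_lt_iff.mp hlt
    exact ⟨m, Nat.lt_succ_iff.mp (by exact_mod_cast hm), m.2⟩
  · rintro ⟨k, hk, h0⟩
    exact (iInf_le _ (⟨k, h0⟩ : {m : ℕ // Y m ω = 0})).trans (by exact_mod_cast hk)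

lemma mulVec_cons_zero {P : Matrix (Fin (K + 1)) (Fin (K + 1)) ℝ}
    (g : Fin K → ℝ) (z : Fin K) :
    (P *ᵥ (Fin.cons 0 g : Fin (K + 1) → ℝ)) z.succ = (subTransition P *ᵥ g) z := by
  simp [Matrix.mulVec, dotProduct, Fin.sum_univ_succ, subTransition]

variable [MeasurableSpace Ω] {μ : Measure Ω} [IsProbabilityMeasure μ] {Y : ℕ → Ω → Fin (K + 1)}
  {P : Matrix (Fin (K + 1)) (Fin (K + 1)) ℝ} {x : Fin K}

/-- The Markov property of the killed chain: one step acts on functions of the current state by the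
sub-transition matrix. -/
lemma integral_killed_succ (hP : ∀ i j, 0 ≤ P i j) (H : IsMarkovChainFrom P x.succ μ Y)
    (F : Fin (K + 1) → ℝ) {k n : ℕ} (hk : k ≤ n) (g : Fin K → ℝ) :
    ∫ ω, {ω | ((n + 1 : ℕ) : ℕ∞) < absorptionTime Y ω}.indicator
        (fun ω => F (Y k ω) * (Fin.cons 0 g : Fin (K + 1) → ℝ) (Y (n + 1) ω)) ω ∂μ =
      ∫ ω, {ω | (n : ℕ∞) < absorptionTime Y ω}.indicator
        (fun ω => F (Y k ω) *
          (Fin.cons 0 (subTransition P *ᵥ g) : Fin (K + 1) → ℝ) (Y n ω)) ω ∂μ := by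
  classical
  let G : (Fin (n + 1) → Fin (K + 1)) → ℝ := fun a =>
    if ∀ i, a i ≠ 0 then F (a ⟨k, Nat.lt_succ_of_le hk⟩) else 0
  have hG : ∀ ω, (∀ i : Fin (n + 1), Y i ω ≠ 0) ↔ (n : ℕ∞) < absorptionTime Y ω := fun ω => by
    rw [lt_absorptionTime_iff]
    exact ⟨fun h k hk => h ⟨k, Nat.lt_succ_of_le hk⟩, fun h i => h i (Nat.lt_succ_iff.mp i.2)⟩
  -- Survival up to time `n + 1` is survival up to `n` once `Y (n + 1) = 0` contributes zero.
  refine Eq.trans ?_ ((H.integral_history_mul_next hP G (Fin.cons 0 g)).trans ?_)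
  · refine integral_congr_ae (ae_of_all _ fun ω => ?_)
    simp only [Set.indicator_apply, Set.mem_ofPred_eq, G, hG]
    by_cases h0 : Y (n + 1) ω = 0
    · simp [h0]
    · have hiff : ((n + 1 : ℕ) : ℕ∞) < absorptionTime Y ω ↔ (n : ℕ∞) < absorptionTime Y ω := by
        rw [lt_absorptionTime_iff, lt_absorptionTime_iff]
        exact ⟨fun h k hk => h k (Nat.le_succ_of_le hk),
          fun h k hk => (Nat.le_succ_iff.mp hk).elim (h k) fun hk => hk ▸ h0⟩
      simp only [hiff, ite_mul, zero_mul]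
  · refine integral_congr_ae (ae_of_all _ fun ω => ?_)
    simp only [Set.indicator_apply, Set.mem_ofPred_eq, G, hG, ite_mul, zero_mul]
    split_ifs with h
    · obtain ⟨z, hz⟩ := Fin.exists_succ_eq.mpr (lt_absorptionTime_iff.mp h n le_rfl)
      rw [← hz, mulVec_cons_zero, Fin.cons_succ]
    · rfl

lemma integral_killed_add (hP : ∀ i j, 0 ≤ P i j) (H : IsMarkovChainFrom P x.succ μ Y)
    (F : Fin (K + 1) → ℝ) (k m : ℕ) (g : Fin K → ℝ) :
    ∫ ω, {ω | ((k + m : ℕ) : ℕ∞) < absorptionTime Y ω}.indicator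
        (fun ω => F (Y k ω) * (Fin.cons 0 g : Fin (K + 1) → ℝ) (Y (k + m) ω)) ω ∂μ =
      ∫ ω, {ω | (k : ℕ∞) < absorptionTime Y ω}.indicator
        (fun ω => F (Y k ω) *
          (Fin.cons 0 ((subTransition P ^ m) *ᵥ g) : Fin (K + 1) → ℝ) (Y k ω)) ω ∂μ := by
  induction m generalizing g with
  | zero => simp
  | succ m ih =>
    rw [← add_assoc, integral_killed_succ hP H F (Nat.le_add_right k m), ih, Matrix.mulVec_mulVec,
      ← pow_succ]

lemma integral_killed (hP : ∀ i j, 0 ≤ P i j) (H : IsMarkovChainFrom P x.succ μ Y) (k : ℕ)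
    (g : Fin K → ℝ) :
    ∫ ω, {ω | (k : ℕ∞) < absorptionTime Y ω}.indicator
        (fun ω => (Fin.cons 0 g : Fin (K + 1) → ℝ) (Y k ω)) ω ∂μ =
      ((subTransition P ^ k) *ᵥ g) x := by
  have h := integral_killed_add hP H (fun _ => 1) 0 k g
  simp only [zero_add, one_mul] at h
  rw [h]
  have hae : ∀ᵐ ω ∂μ, {ω | ((0 : ℕ) : ℕ∞) < absorptionTime Y ω}.indicator
      (fun ω => (Fin.cons 0 ((subTransition P ^ k) *ᵥ g) : Fin (K + 1) → ℝ) (Y 0 ω)) ω =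
        ((subTransition P ^ k) *ᵥ g) x := by
    filter_upwards [H.initial] with ω hω
    rw [Set.indicator_of_mem, hω, Fin.cons_succ]
    refine lt_absorptionTime_iff.mpr fun k hk => ?_
    rw [Nat.le_zero.mp hk, hω]
    exact Fin.succ_ne_zero x
  rw [integral_congr_ae hae]
  simp

/-- The two-sided formula: `n - k` steps after time `k` count the survivors, and the `k` steps
before it distribute the weight `f`. -/
theorem killedMean_eq (hP : ∀ i j, 0 ≤ P i j) (H : IsMarkovChainFrom P x.succ μ Y)
    (f : Fin K → ℝ) (n : ℕ) :
    killedMean μ Y f n = (n : ℝ)⁻¹ * ∑ k ∈ Finset.range n, ((subTransition P ^ k) *ᵥ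
      fun z => f z * ((subTransition P ^ (n - k)) *ᵥ 1) z) x := by
  have hmeas : ∀ n : ℕ, MeasurableSet {ω | (n : ℕ∞) < absorptionTime Y ω} := fun n => by
    simp only [lt_absorptionTime_iff, Set.ofPred_forall]
    exact MeasurableSet.iInter fun k => MeasurableSet.iInter fun _ =>
      (H.measurable k (measurableSet_singleton 0)).compl
  have hpt : ∀ ω, {ω | (n : ℕ∞) < absorptionTime Y ω}.indicator
      (fun ω => (1 / (n : ℝ)) * ∑ k ∈ Finset.range n, (Fin.cons 0 f : Fin (K + 1) → ℝ) (Y k ω)) ω =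
      (n : ℝ)⁻¹ * ∑ k ∈ Finset.range n, {ω | (n : ℕ∞) < absorptionTime Y ω}.indicator
        (fun ω => (Fin.cons 0 f : Fin (K + 1) → ℝ) (Y k ω)) ω := fun ω => by
    simp only [Set.indicator_apply]
    split_ifs <;> simp
  rw [killedMean]
  simp only [hpt]
  rw [integral_const_mul, integral_finsetSum _ fun k _ =>
    (integrable_comp H.measurable _ k).indicator (hmeas n)]
  congr 1
  refine Finset.sum_congr rfl fun k hk => ?_
  obtain ⟨m, rfl⟩ := Nat.exists_eq_add_of_le (Finset.mem_range.mp hk).le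
  rw [Nat.add_sub_cancel_left, ← integral_killed hP H]
  refine Eq.trans ?_ ((integral_killed_add hP H (Fin.cons 0 f) k m 1).trans ?_)
  · refine integral_congr_ae (ae_of_all _ fun ω => ?_)
    simp only [Set.indicator_apply, Set.mem_ofPred_eq]
    split_ifs with h
    · obtain ⟨z, hz⟩ := Fin.exists_succ_eq.mpr (lt_absorptionTime_iff.mp h _ le_rfl)
      rw [← hz, Fin.cons_succ, Pi.one_apply, mul_one]
    · rfl
  · refine integral_congr_ae (ae_of_all _ fun ω => ?_)
    simp only [Set.indicator_apply]
    congr 1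
    refine Fin.cases ?_ (fun z => ?_) (Y k ω) <;> simp

end Killing

end QuasiErgodic

/-! ### Doob transform and peripheral eigenvectors -/

namespace QuasiErgodic

section DoobTransform

open Matrix

variable {ι : Type*} [Fintype ι] [DecidableEq ι]

/-- The Doob transform `Q(x, y) ξ(y) / (ρ ξ(x))` of `Q`, which is stochastic when `Q ξ = ρ ξ`. -/
noncomputable def doobTransform (Q : Matrix ι ι ℝ) (ρ : ℝ) (ξ : ι → ℝ) : Matrix ι ι ℝ :=
  Matrix.of fun x y => Q x y * ξ y / (ρ * ξ x)

lemma doobTransform_pow_apply {Q : Matrix ι ι ℝ} {ρ : ℝ} {ξ : ι → ℝ} (hξ : ∀ x, 0 < ξ x)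
    (n : ℕ) (x y : ι) :
    (doobTransform Q ρ ξ ^ n) x y = (Q ^ n) x y * ξ y / (ρ ^ n * ξ x) := by
  induction n generalizing y with
  | zero =>
    rcases eq_or_ne x y with rfl | h
    · simp [(hξ x).ne']
    · simp [Matrix.one_apply_ne h]
  | succ n ih =>
    rw [pow_succ, pow_succ, Matrix.mul_apply, Matrix.mul_apply, Finset.sum_mul, Finset.sum_div]
    refine Finset.sum_congr rfl fun z _ => ?_
    rw [ih, doobTransform, Matrix.of_apply, div_mul_div_comm,
      ← mul_div_mul_right ((Q ^ n) x z * Q z y * ξ y) _ (hξ z).ne']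
    congr 1 <;> ring

lemma pow_mulVec_eq_doobTransform {Q : Matrix ι ι ℝ} {ρ : ℝ} (hρ : 0 < ρ) {ξ : ι → ℝ}
    (hξ : ∀ x, 0 < ξ x) (n : ℕ) (g : ι → ℝ) (x : ι) :
    ((Q ^ n) *ᵥ fun y => ξ y * g y) x =
      ρ ^ n * ξ x * ((doobTransform Q ρ ξ ^ n) *ᵥ g) x := by
  simp only [Matrix.mulVec, dotProduct, Finset.mul_sum]
  refine Finset.sum_congr rfl fun y _ => ?_
  rw [doobTransform_pow_apply hξ, ← mul_assoc, ← mul_assoc,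
    mul_div_cancel₀ _ (mul_pos (pow_pos hρ n) (hξ x)).ne']

end DoobTransform

section PerronPair

open Matrix

variable {K : ℕ} {Q : Matrix (Fin K) (Fin K) ℝ} {o : Fin K} {ν ξ : Fin K → ℝ}

lemma specRad_pos (hQ : ∀ i j, 0 ≤ Q i j) (hT : period Q o ≠ 0) (h : IsPerronPair Q ν ξ) :
    0 < specRad Q := by
  obtain ⟨d, hd0, hd⟩ := exists_pos_pow_apply_self hT
  refine lt_of_le_of_ne ENNReal.toReal_nonneg fun h0 => ?_
  have heig := congrFun (pow_mulVec_eigen h.right_eigen d) o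
  rw [← h0, zero_pow hd0, zero_smul, Pi.zero_apply] at heig
  refine (Finset.sum_pos' (fun y _ => ?_) ⟨o, Finset.mem_univ o, ?_⟩).ne' heig
  · exact mul_nonneg (pow_apply_nonneg hQ d o y) (h.right_pos y).le
  · exact mul_pos hd (h.right_pos o)

/-- The invariant probability of the Doob transform is `ν ξ`. -/
theorem isCyclicChain_doobTransform (hQ : ∀ i j, 0 ≤ Q i j) (hirr : Irred Q)
    (hT : period Q o ≠ 0) (h : IsPerronPair Q ν ξ) :
    IsCyclicChain (doobTransform Q (specRad Q) ξ) (fun y => ν y * ξ y)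
      (fun y => (classIndex Q o y : ZMod (period Q o))) := by
  have hρ := specRad_pos hQ hT h
  have hξ := h.right_pos
  have hR : ∀ x y, doobTransform Q (specRad Q) ξ x y = Q x y * ξ y / (specRad Q * ξ x) :=
    fun _ _ => rfl
  refine ⟨fun x y => ?_, fun x => ?_, fun x => mul_pos (h.left_pos x) (hξ x), ?_,
    h.pair_normalized, fun x y hxy => ?_, ?_⟩
  · exact div_nonneg (mul_nonneg (hQ x y) (hξ y).le) (mul_pos hρ (hξ x)).le
  · simp only [hR]
    rw [← Finset.sum_div]
    have := congrFun h.right_eigen x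
    simp only [Matrix.mulVec, dotProduct, Pi.smul_apply, smul_eq_mul] at this
    rw [this, div_self (mul_pos hρ (hξ x)).ne']
  · ext y
    have := congrFun h.left_eigen y
    simp only [Matrix.vecMul, dotProduct, Pi.smul_apply, smul_eq_mul, hR] at this ⊢
    calc ∑ x, ν x * ξ x * (Q x y * ξ y / (specRad Q * ξ x))
        = ∑ x, ν x * Q x y * (ξ y / specRad Q) := by
          refine Finset.sum_congr rfl fun x _ => ?_
          have := (hξ x).ne'
          field_simp
      _ = ν y * ξ y := by
          rw [← Finset.sum_mul, this]
          field_simp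
  · have hpos : 0 < (Q ^ 1) x y := by
      rw [pow_one]
      refine lt_of_le_of_ne (hQ x y) fun h0 => hxy ?_
      rw [hR, ← h0, zero_mul, zero_div]
    simpa using cast_classIndex_eq_add hQ hirr hT hpos
  · obtain ⟨N, hN⟩ := exists_forall_pow_apply_pos hQ hirr hT
    refine ⟨N, fun x y hxy => ?_⟩
    rw [doobTransform_pow_apply hξ]
    exact div_pos (mul_pos (hN x y hxy) (hξ y)) (mul_pos (pow_pos hρ N) (hξ x))

/-- The primitive `T`-th root of unity `e^{2iπ/T}`. -/
noncomputable def cyclicRoot (T : ℕ) : ℂ := Complex.exp (2 * Real.pi * Complex.I / T)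

lemma cyclicRoot_ne_zero (T : ℕ) : cyclicRoot T ≠ 0 := Complex.exp_ne_zero _

lemma isPrimitiveRoot_cyclicRoot {T : ℕ} (hT : T ≠ 0) : IsPrimitiveRoot (cyclicRoot T) T :=
  Complex.isPrimitiveRoot_exp T hT

lemma exp_eq_cyclicRoot_pow_pow (T k l : ℕ) :
    Complex.exp (2 * Complex.I * Real.pi * (k : ℂ) * l / (T : ℂ)) =
      (cyclicRoot T ^ k) ^ l := by
  rw [cyclicRoot, ← Complex.exp_nat_mul, ← Complex.exp_nat_mul]
  congr 1
  ring

lemma cyclicRoot_pow_eq_pow_iff {T : ℕ} (hT : T ≠ 0) {a b : ℕ} :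
    cyclicRoot T ^ a = cyclicRoot T ^ b ↔
      (a : ZMod T) = b := by
  have h := (isPrimitiveRoot_cyclicRoot hT).zpow_eq_one_iff_dvd ((b : ℤ) - a)
  rw [zpow_sub₀ (cyclicRoot_ne_zero T), zpow_natCast, zpow_natCast,
    div_eq_one_iff_eq (pow_ne_zero a (cyclicRoot_ne_zero T)), eq_comm,
    ← ZMod.intCast_eq_intCast_iff_dvd_sub, Int.cast_natCast, Int.cast_natCast] at h
  exact h

lemma peripheral_eq (Q : Matrix (Fin K) (Fin K) ℝ) (o : Fin K) (l : ℕ) :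
    peripheral Q o l =
      specRad Q * cyclicRoot (period Q o) ^ l := by
  rw [peripheral, cyclicRoot, ← Complex.exp_nat_mul]
  congr 2
  ring

lemma leftVec_eq (Q : Matrix (Fin K) (Fin K) ℝ) (o : Fin K) (ν : Fin K → ℝ) (l : ℕ) (y : Fin K) :
    leftVec Q o ν l y = ((cyclicRoot (period Q o) ^
      classIndex Q o y) ^ l)⁻¹ * ν y := by
  rw [leftVec, Complex.exp_neg, exp_eq_cyclicRoot_pow_pow]

lemma rightVec_eq (Q : Matrix (Fin K) (Fin K) ℝ) (o : Fin K) (ξ : Fin K → ℝ) (l : ℕ) (y : Fin K) :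
    rightVec Q o ξ l y = (cyclicRoot (period Q o) ^
      classIndex Q o y) ^ l * ξ y := by
  rw [rightVec, exp_eq_cyclicRoot_pow_pow]

lemma cyclicRoot_pow_classIndex (hQ : ∀ i j, 0 ≤ Q i j) (hirr : Irred Q) (hT : period Q o ≠ 0)
    {x y : Fin K} (hxy : Q x y ≠ 0) :
    cyclicRoot (period Q o) ^ classIndex Q o y =
      cyclicRoot (period Q o) ^ classIndex Q o x *
        cyclicRoot (period Q o) := by
  rw [← pow_succ, cyclicRoot_pow_eq_pow_iff hT]
  exact_mod_cast cast_classIndex_eq_add (n := 1) hQ hirr hT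
    (by rw [pow_one]; exact lt_of_le_of_ne (hQ x y) hxy.symm)

theorem vecMul_leftVec (hQ : ∀ i j, 0 ≤ Q i j) (hirr : Irred Q) (hT : period Q o ≠ 0)
    (hν : ν ᵥ* Q = specRad Q • ν) (l : ℕ) :
    leftVec Q o ν l ᵥ* (Q.map ((↑) : ℝ → ℂ)) = peripheral Q o l • leftVec Q o ν l := by
  ext y
  rw [Pi.smul_apply, smul_eq_mul, leftVec_eq, peripheral_eq]
  set η := cyclicRoot (period Q o) with hη_def
  have hη : η ≠ 0 := cyclicRoot_ne_zero _
  have heig : ∑ x, (ν x : ℂ) * Q x y = specRad Q * ν y := by exact_mod_cast congrFun hν y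
  calc ∑ x, leftVec Q o ν l x * (Q x y : ℂ)
      = ∑ x, η ^ l * ((η ^ classIndex Q o y) ^ l)⁻¹ * (ν x * Q x y) := by
        refine Finset.sum_congr rfl fun x _ => ?_
        by_cases hxy : Q x y = 0
        · simp [hxy]
        · rw [leftVec_eq, cyclicRoot_pow_classIndex hQ hirr hT hxy, mul_pow, ← hη_def]
          field_simp
    _ = _ := by rw [← Finset.mul_sum, heig]; ring

theorem mulVec_rightVec (hQ : ∀ i j, 0 ≤ Q i j) (hirr : Irred Q) (hT : period Q o ≠ 0)
    (hξ : Q *ᵥ ξ = specRad Q • ξ) (l : ℕ) :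
    (Q.map ((↑) : ℝ → ℂ)) *ᵥ rightVec Q o ξ l = peripheral Q o l • rightVec Q o ξ l := by
  ext x
  rw [Pi.smul_apply, smul_eq_mul, rightVec_eq, peripheral_eq]
  set η := cyclicRoot (period Q o) with hη_def
  have heig : ∑ y, (Q x y : ℂ) * ξ y = specRad Q * ξ x := by exact_mod_cast congrFun hξ x
  calc ∑ y, (Q x y : ℂ) * rightVec Q o ξ l y
      = ∑ y, η ^ l * (η ^ classIndex Q o x) ^ l * (Q x y * ξ y) := by
        refine Finset.sum_congr rfl fun y _ => ?_
        by_cases hxy : Q x y = 0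
        · simp [hxy]
        · rw [rightVec_eq, cyclicRoot_pow_classIndex hQ hirr hT hxy, mul_pow]
          ring
    _ = _ := by rw [← Finset.mul_sum, heig]; ring

/-- The characters of the cyclic group select one class. -/
lemma sum_range_cyclicRoot_pow {T : ℕ} (hT : T ≠ 0) (a b n : ℕ) :
    ∑ l ∈ Finset.range T, ((cyclicRoot T ^ n) ^ l)⁻¹ *
      ((cyclicRoot T ^ a) ^ l)⁻¹ *
        (cyclicRoot T ^ b) ^ l =
      if (b : ZMod T) = a + n then (T : ℂ) else 0 := by
  have hprim := isPrimitiveRoot_cyclicRoot hT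
  have hiff := cyclicRoot_pow_eq_pow_iff hT (a := b) (b := a + n)
  set η := cyclicRoot T
  have hη : η ≠ 0 := cyclicRoot_ne_zero _
  have hq : ∀ l, ((η ^ n) ^ l)⁻¹ * ((η ^ a) ^ l)⁻¹ * (η ^ b) ^ l = (η ^ b / η ^ (a + n)) ^ l := by
    intro l
    rw [div_pow, pow_add, mul_pow, div_eq_mul_inv, mul_inv]
    ring
  simp only [hq]
  push_cast at hiff
  split_ifs with h
  · rw [hiff.mpr h, div_self (pow_ne_zero _ hη)]
    simp
  · have hq1 : η ^ b / η ^ (a + n) ≠ 1 := fun h1 =>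
      h (hiff.mp ((div_eq_one_iff_eq (pow_ne_zero _ hη)).mp h1))
    rw [geom_sum_eq hq1, div_pow, ← pow_mul, ← pow_mul, mul_comm b, mul_comm (a + n), pow_mul,
      pow_mul, hprim.pow_eq_one]
    simp

lemma conj_cyclicRoot_pow_pow (T k l : ℕ) :
    (starRingEnd ℂ) ((cyclicRoot T ^ k) ^ l) =
      ((cyclicRoot T ^ k) ^ l)⁻¹ := by
  rw [map_pow, map_pow, ← inv_pow, ← inv_pow, cyclicRoot, ← Complex.exp_conj, ← Complex.exp_neg]
  congr 3
  simp [neg_div, Complex.conj_ofNat]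

/-- The spectral sum is `T ξ(x)` times the mass that `ν` gives to the class reached from `x` in `n`
steps. That mass appears as the class mean of `1 / ξ` under `ν ξ`, which already carries the `T`. -/
theorem sum_peripheral_eq_classMean (hT : period Q o ≠ 0) (hξ : ∀ y, 0 < ξ y) (x : Fin K) (n : ℕ) :
    ∑ l ∈ Finset.range (period Q o),
        Complex.exp (-(2 * Complex.I * n * l * Real.pi / (period Q o : ℂ))) *
          herm (rightVec Q o ξ l) (Pi.single x 1) * herm (leftVec Q o ν l) 1 =
      ((ξ x * classMean (fun y => (classIndex Q o y : ZMod (period Q o))) (fun y => ν y * ξ y)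
        (fun y => (ξ y)⁻¹) (classIndex Q o x + n) : ℝ) : ℂ) := by
  have hexp : ∀ l : ℕ, Complex.exp (-(2 * Complex.I * n * l * Real.pi / (period Q o : ℂ))) =
      ((cyclicRoot (period Q o) ^ n) ^ l)⁻¹ := fun l => by
    rw [← exp_eq_cyclicRoot_pow_pow, ← Complex.exp_neg]
    congr 1
    ring
  have hright : ∀ l, herm (rightVec Q o ξ l) (Pi.single x 1) =
      ((cyclicRoot (period Q o) ^ classIndex Q o x) ^ l)⁻¹ *
        ξ x := fun l => by
    simp only [herm, PiLp.inner_apply, RCLike.inner_apply]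
    rw [Finset.sum_eq_single x (fun y _ hy => by simp [hy]) (by simp), Pi.single_eq_same, one_mul,
      rightVec_eq, map_mul, conj_cyclicRoot_pow_pow, Complex.conj_ofReal]
  have hleft : ∀ l, herm (leftVec Q o ν l) 1 = ∑ y,
      (cyclicRoot (period Q o) ^ classIndex Q o y) ^ l *
        ν y := fun l => by
    simp only [herm, PiLp.inner_apply, RCLike.inner_apply, Pi.one_apply, one_mul]
    refine Finset.sum_congr rfl fun y _ => ?_
    rw [leftVec_eq, map_mul, map_inv₀, conj_cyclicRoot_pow_pow, inv_inv, Complex.conj_ofReal]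
  simp only [hexp, hright, hleft, Finset.mul_sum]
  rw [Finset.sum_comm, classMean]
  push_cast
  rw [Finset.mul_sum, Finset.mul_sum]
  refine Finset.sum_congr rfl fun y _ => ?_
  have hsum := sum_range_cyclicRoot_pow hT (classIndex Q o x) (classIndex Q o y) n
  have hξy : (ξ y : ℂ) ≠ 0 := Complex.ofReal_ne_zero.mpr (hξ y).ne'
  calc _ = (∑ l ∈ Finset.range (period Q o),
        ((cyclicRoot (period Q o) ^ n) ^ l)⁻¹ *
        ((cyclicRoot (period Q o) ^ classIndex Q o x) ^ l)⁻¹ *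
          (cyclicRoot (period Q o) ^ classIndex Q o y) ^ l) *
            (ξ x * ν y) := by
        rw [Finset.sum_mul]
        exact Finset.sum_congr rfl fun l _ => by ring
    _ = _ := by
        rw [hsum]
        split_ifs
        · push_cast
          field_simp
        · simp

/-- The two-sided ergodic theorem for the Doob transform with payoff `1 / ξ`, transported back to
`Q`: the powers of `ρ` combine to `ρ ^ n`, whatever the intermediate time `k`. -/
theorem isLittleO_two_sided_sub (hQ : ∀ i j, 0 ≤ Q i j) (hirr : Irred Q) (hT : period Q o ≠ 0)
    (h : IsPerronPair Q ν ξ) (f : Fin K → ℝ) (x : Fin K) :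
    (fun n : ℕ => (n : ℝ)⁻¹ * ∑ k ∈ Finset.range n,
        ((Q ^ k) *ᵥ fun z => f z * ((Q ^ (n - k)) *ᵥ 1) z) x - specRad Q ^ n * phi ν ξ f *
          (ξ x * classMean (fun y => (classIndex Q o y : ZMod (period Q o))) (fun y => ν y * ξ y)
            (fun y => (ξ y)⁻¹) (classIndex Q o x + n)))
      =o[atTop] fun n : ℕ => specRad Q ^ n := by
  have : NeZero (period Q o) := ⟨hT⟩
  have hρ := specRad_pos hQ hT h
  have hξ := h.right_pos
  set ρ := specRad Q
  set R := doobTransform Q ρ ξ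
  have hlim := ((isCyclicChain_doobTransform hQ hirr hT h).tendsto_cesaro_two_sided f
    (fun y => (ξ y)⁻¹) x).const_mul (ξ x)
  rw [mul_zero] at hlim
  have ho := (isBigO_refl (fun n : ℕ => ρ ^ n) atTop).mul_isLittleO ((isLittleO_one_iff ℝ).mpr hlim)
  simp only [mul_one] at ho
  refine ho.congr_left fun n => ?_
  have hone : (1 : Fin K → ℝ) = fun y => ξ y * (ξ y)⁻¹ :=
    funext fun y => (mul_inv_cancel₀ (hξ y).ne').symm
  have hk : ∀ k ∈ Finset.range n, ((Q ^ k) *ᵥ fun z => f z * ((Q ^ (n - k)) *ᵥ 1) z) x =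
      ρ ^ n * ξ x * ((R ^ k) *ᵥ fun z => f z * ((R ^ (n - k)) *ᵥ fun y => (ξ y)⁻¹) z) x := by
    intro k hk
    have hinner : (fun z => f z * ((Q ^ (n - k)) *ᵥ 1) z) = ρ ^ (n - k) • fun z =>
        ξ z * (f z * ((R ^ (n - k)) *ᵥ fun y => (ξ y)⁻¹) z) := by
      ext z
      rw [hone, pow_mulVec_eq_doobTransform hρ hξ, Pi.smul_apply, smul_eq_mul]
      ring
    have hpow : ρ ^ (n - k) * ρ ^ k = ρ ^ n := by
      rw [← pow_add, Nat.sub_add_cancel (Finset.mem_range.mp hk).le]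
    rw [hinner, Matrix.mulVec_smul, Pi.smul_apply, smul_eq_mul, pow_mulVec_eq_doobTransform hρ hξ,
      ← hpow]
    ring
  have hphi : phi ν ξ f = ∑ y, ν y * ξ y * f y :=
    Finset.sum_congr rfl fun y _ => by ring
  rw [Finset.sum_congr rfl hk, ← Finset.mul_sum, hphi]
  ring

/-- An irreducible matrix has period zero only if it is the `1 × 1` zero matrix. -/
lemma eq_zero_of_period_eq_zero (hQ : ∀ i j, 0 ≤ Q i j) (hirr : Irred Q) (hT : period Q o = 0) :
    Q = 0 := by
  have hret : ∀ n, 0 < (Q ^ n) o o → n = 0 := fun n hn =>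
    Nat.eq_zero_of_zero_dvd (hT ▸ period_dvd_of_pow_pos hn)
  have heq : ∀ y, y = o := fun y => by
    obtain ⟨a, ha⟩ := hirr o y
    obtain ⟨b, hb⟩ := hirr y o
    obtain rfl : a = 0 := by
      have := hret _ (pow_add_apply_pos hQ ha hb)
      omega
    by_contra hne
    rw [pow_zero, Matrix.one_apply_ne (Ne.symm hne)] at ha
    exact lt_irrefl _ ha
  ext x y
  rw [heq x, heq y, Matrix.zero_apply]
  refine le_antisymm (not_lt.mp fun hpos => ?_) (hQ o o)
  exact one_ne_zero (hret 1 (by rwa [pow_one]))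

end PerronPair

end QuasiErgodic

theorem mainTheorem3 {K : ℕ} (P : Matrix (Fin (K + 1)) (Fin (K + 1)) ℝ)
    (hP : P ∈ Matrix.rowStochastic ℝ (Fin (K + 1))) (hP0 : P 0 0 = 1)
    (Q : Matrix (Fin K) (Fin K) ℝ) (hQ : Q = QuasiErgodic.subTransition P)
    (hirr : QuasiErgodic.Irred Q) (o : Fin K) :
    (∀ y, QuasiErgodic.period Q y = QuasiErgodic.period Q o) ∧
    (∃ ν ξ : Fin K → ℝ, QuasiErgodic.IsPerronPair Q ν ξ) ∧
    ∀ ν ξ : Fin K → ℝ, QuasiErgodic.IsPerronPair Q ν ξ →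
      (∀ l < QuasiErgodic.period Q o,
        Matrix.vecMul (QuasiErgodic.leftVec Q o ν l) (Q.map ((↑) : ℝ → ℂ)) =
            QuasiErgodic.peripheral Q o l • QuasiErgodic.leftVec Q o ν l ∧
        Matrix.mulVec (Q.map ((↑) : ℝ → ℂ)) (QuasiErgodic.rightVec Q o ξ l) =
            QuasiErgodic.peripheral Q o l • QuasiErgodic.rightVec Q o ξ l) ∧
      ∀ (f : Fin K → ℝ) (x : Fin K) {Ω : Type*} [MeasurableSpace Ω] (μ : Measure Ω)
        [IsProbabilityMeasure μ] (Y : ℕ → Ω → Fin (K + 1)),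
        QuasiErgodic.IsMarkovChainFrom P x.succ μ Y →
        (fun n : ℕ =>
          ((QuasiErgodic.killedMean μ Y f n : ℝ) : ℂ) -
            (QuasiErgodic.specRad Q : ℂ) ^ n * (QuasiErgodic.phi ν ξ f : ℂ) *
              ∑ l ∈ Finset.range (QuasiErgodic.period Q o),
                Complex.exp (-(2 * Complex.I * n * l * Real.pi / (QuasiErgodic.period Q o : ℂ))) *
                  QuasiErgodic.herm (QuasiErgodic.rightVec Q o ξ l) (Pi.single x 1) *
                  QuasiErgodic.herm (QuasiErgodic.leftVec Q o ν l) 1)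
          =o[atTop] fun n : ℕ => QuasiErgodic.specRad Q ^ n := by
  have hPnn : ∀ i j, 0 ≤ P i j := fun i j => Matrix.nonneg_of_mem_rowStochastic hP
  have hQnn : ∀ i j, 0 ≤ Q i j := fun i j => by rw [hQ]; exact hPnn _ _
  have : NeZero K := ⟨fun h => (Fin.cast h o).elim0⟩
  refine ⟨fun y => QuasiErgodic.period_eq_period hQnn hirr y o,
    QuasiErgodic.exists_isPerronPair hQnn hirr, fun ν ξ hνξ => ⟨fun l hl => ?_, ?_⟩⟩
  · exact ⟨QuasiErgodic.vecMul_leftVec hQnn hirr (by omega) hνξ.left_eigen l,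
      QuasiErgodic.mulVec_rightVec hQnn hirr (by omega) hνξ.right_eigen l⟩
  intro f x Ω _ μ _ Y hY
  have hmean := fun n => QuasiErgodic.killedMean_eq hPnn hY f n
  rw [← hQ] at hmean
  by_cases hT : QuasiErgodic.period Q o = 0
  · -- Here `Q = 0`: the spectral sum is empty and the killed mean vanishes as well.
    have hQ0 := QuasiErgodic.eq_zero_of_period_eq_zero hQnn hirr hT
    refine (isLittleO_zero _ _).congr_left fun n => ?_
    have hkill : QuasiErgodic.killedMean μ Y f n = 0 := by
      rw [hmean, Finset.sum_eq_zero, mul_zero]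
      intro k hk
      rw [hQ0, zero_pow (Nat.sub_ne_zero_of_lt (Finset.mem_range.mp hk))]
      simp [Matrix.mulVec, dotProduct]
    rw [hkill, hT]
    simp
  · refine ((QuasiErgodic.isLittleO_two_sided_sub hQnn hirr hT hνξ f x).norm_left.congr_left
      fun n => ?_).of_norm_left
    rw [QuasiErgodic.sum_peripheral_eq_classMean hT hνξ.right_pos, hmean, ← Complex.norm_real]
    push_cast
    rfl
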